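/- Let $\alpha=(\alpha_1\ge\dots\ge\alpha_{\ell(\alpha)})$ be a partition with all parts $\ge 2$. Let $R_\alpha^p$ be a ribbon, i.e. a skew shape (not necessarily connected) containing no $2\times2$ block, whose row lengths from top to bottom are $\alpha_1,\dots,\alpha_{\ell(\alpha)}$, and let $p=(p_1,\dots,p_{\ell(\alpha)-1},0)$ be its overlapping partition: $p_i$ is the number of columns of length two in the last $\ell(\alpha)-i+1$ rows of $R_\alpha^p$. Write $\ell(p)$ for the number of positive entries of $p$. Let $\nu$ be a partition of $|\alpha|$, with $\nu_i=0$ for $i$ larger than its length, and let $c^{\nu}_{R_\alpha^p}$ be the Littlewood–Richardson coefficient, i.e. the number of semistandard tableaux of shape $R_\alpha^p$ and content $\nu$ whose reading word (right to left in each row, rows from top to bottom) is Yamanouchi. Then $$c^{\nu}_{R_\alpha^p}>0\iff \nu\in[\alpha,(|\alpha|-p_1,p_1)]\ \text{ and }\ \nu_i\le\sum_{q=i}^{\ell(\alpha)}\alpha_q-p_i\ \text{ for } 1\le i\le\ell(p),\qquad(*)$$ where $[\cdot,\cdot]$ is an interval in the dominance order on partitions of $|\alpha|$. In particular, for $p_i=\ell(\alpha)-i$,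 $1\le i\le\ell(\alpha)$ (the overlapping partition of the connected ribbon with row lengths $\alpha$), there is a standard Young tableau of shape $\nu$ with descent set $\mathcal S(\alpha)=\{\alpha_1,\alpha_1+\alpha_2,\dots,\alpha_1+\dots+\alpha_{\ell(\alpha)-1}\}$ if and only if the right-hand side of $(*)$ holds. Here the descent set of a standard Young tableau is the set of entries $k$ such that $k+1$ lies in a strictly lower row than $k$. -/

import Mathlib

/-! Conventions. A partition is a Mathlib `YoungDiagram`: `α.rowLen i` is its part number `i + 1`
(rows, columns and sequences are indexed from `0`, and parts are padded by zeros), `α.colLen 0` is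
its length and `α.card` its size. Row `0` is the top row. Letters of tableaux are positive integers. -/

namespace MonotoneRibbon

open Finset

/-- The boxes of the skew shape `lam / mu`. -/
def skewCells (lam mu : YoungDiagram) : Finset (ℕ × ℕ) := lam.cells \ mu.cells

/-- `lam / mu` is a ribbon (not necessarily connected) whose row lengths, from top to bottom, are
the parts of `α`: it is a skew shape that contains no `2 × 2` block. Empty columns between two
consecutive rows are allowed, so that every position of the boxes is covered, not only the
representative without empty columns. -/
structure IsRibbonWithRows (α lam mu : YoungDiagram) : Prop where
  contained : mu ≤ lam
  rows : ∀ i, lam.rowLen i - mu.rowLen i = α.rowLen i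
  no_square : ∀ i j, ¬ ((i, j) ∈ skewCells lam mu ∧ (i, j + 1) ∈ skewCells lam mu ∧
    (i + 1, j) ∈ skewCells lam mu ∧ (i + 1, j + 1) ∈ skewCells lam mu)

/-- The overlapping partition: its entry number `i + 1` is the number of columns of length two of
the diagram formed by the rows `i, i + 1, …` of `lam / mu` (the rows `0, …, i - 1` are removed). -/
def overlap (lam mu : YoungDiagram) (i : ℕ) : ℕ :=
  #{j ∈ range (lam.rowLen 0) | #{c ∈ skewCells lam mu | c.2 = j ∧ i ≤ c.1} = 2}

/-- Semistandard Young tableaux of skew shape `lam / mu`: positive entries in the boxes, weakly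
increasing along rows, strictly increasing down columns. Outside the shape the entry is `0`. -/
structure SkewSSYT (lam mu : YoungDiagram) where
  entry : ℕ → ℕ → ℕ
  pos : ∀ {i j}, (i, j) ∈ skewCells lam mu → 0 < entry i j
  row_weak : ∀ {i j₁ j₂}, j₁ < j₂ → (i, j₁) ∈ skewCells lam mu → (i, j₂) ∈ skewCells lam mu →
    entry i j₁ ≤ entry i j₂
  col_strict : ∀ {i₁ i₂ j}, i₁ < i₂ → (i₁, j) ∈ skewCells lam mu → (i₂, j) ∈ skewCells lam mu →
    entry i₁ j < entry i₂ j
  zeros : ∀ {i j}, (i, j) ∉ skewCells lam mu → entry i j = 0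

/-- The tableau `T` has content `ν`: for `m ≥ 1` the letter `m` occurs `ν_m` times. -/
def SkewSSYT.HasContent {lam mu : YoungDiagram} (T : SkewSSYT lam mu) (ν : YoungDiagram) : Prop :=
  ∀ m, #{c ∈ skewCells lam mu | T.entry c.1 c.2 = m + 1} = ν.rowLen m

/-- How often the letter `m` occurs in the initial segment, up to and including the position
`(a, b)`, of the reading word of `T`. The word is read from right to left in each row, and the rows
are read from top to bottom. -/
def SkewSSYT.prefixCount {lam mu : YoungDiagram} (T : SkewSSYT lam mu) (a b m : ℕ) : ℕ :=
  #{c ∈ skewCells lam mu | (c.1 < a ∨ (c.1 = a ∧ b ≤ c.2)) ∧ T.entry c.1 c.2 = m}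

/-- The reading word of `T` is a Yamanouchi word: for `m ≥ 1`, each initial segment has at least as
many letters `m` as letters `m + 1`. -/
def SkewSSYT.IsYamanouchi {lam mu : YoungDiagram} (T : SkewSSYT lam mu) : Prop :=
  ∀ a b m, 1 ≤ m → T.prefixCount a b (m + 1) ≤ T.prefixCount a b m

/-- The Littlewood-Richardson coefficient `c_{lam / mu}^ν`: the number of Littlewood-Richardson
tableaux of shape `lam / mu` and content `ν`. The set counted is finite, because the content bounds
the entries. -/
noncomputable def lrCoeff (lam mu ν : YoungDiagram) : ℕ :=
  Nat.card {T : SkewSSYT lam mu // T.HasContent ν ∧ T.IsYamanouchi}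

/-- Dominance `f ⪯ g` for sequences of parts, padded by zeros. It is only used for partitions of
the same number. -/
def Dominated (f g : ℕ → ℕ) : Prop :=
  ∀ k, ∑ i ∈ range k, f i ≤ ∑ i ∈ range k, g i

/-- The sequence `(a, b, 0, 0, …)`. -/
def twoParts (a b : ℕ) (i : ℕ) : ℕ := if i = 0 then a else if i = 1 then b else 0

/-- The right hand side: `ν` lies in the dominance interval `[α, (|α| - p₁, p₁)]`, and
`ν_i ≤ ∑_{q = i}^{ℓ(α)} α_q - p_i` for `1 ≤ i ≤ ℓ(p)`. For a weakly decreasing `p`, the condition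
`i ≤ ℓ(p)` says that the entry number `i` is positive; the subtracted entry is written on the left. -/
def SatisfiesInequalities (α : YoungDiagram) (p : ℕ → ℕ) (ν : YoungDiagram) : Prop :=
  Dominated α.rowLen ν.rowLen ∧ Dominated ν.rowLen (twoParts (α.card - p 0) (p 0)) ∧
    ∀ i, 0 < p i → ν.rowLen i + p i ≤ ∑ q ∈ Ico i (α.colLen 0), α.rowLen q

/-- The semistandard tableau `U` is standard: each of `1, …, n` is the entry of exactly one box,
where `n` is the number of boxes. -/
def IsStandard {ν : YoungDiagram} (U : SemistandardYoungTableau ν) : Prop :=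
  Set.BijOn (fun c : ℕ × ℕ => U c.1 c.2) (ν.cells : Set (ℕ × ℕ)) (Set.Icc 1 ν.card)

/-- The descent set: the entries `k` such that `k + 1` occurs in a strictly lower row than `k`. -/
def descentSet {ν : YoungDiagram} (U : SemistandardYoungTableau ν) : Set ℕ :=
  {k | ∃ i j i' j', (i, j) ∈ ν ∧ (i', j') ∈ ν ∧ U i j = k ∧ U i' j' = k + 1 ∧ i < i'}

/-- The set `S(α) = {α₁, α₁ + α₂, …, α₁ + ⋯ + α_{ℓ(α) - 1}}`. -/
def partialSums (α : YoungDiagram) : Set ℕ :=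
  {s | ∃ k, 1 ≤ k ∧ k < α.colLen 0 ∧ s = ∑ q ∈ range k, α.rowLen q}

end MonotoneRibbon

/-! Only the numbers X j i of letters i in row j matter (letters from 0). As rows increase weakly,
the Yamanouchi condition says that the letters of row j add a horizontal strip to the shape made by
the earlier rows (field `strip` of `StripMatrix`). A column of length two joins the first box of a
row to the last box of the next one, so strictness there only asks that some letter of row j be
smaller than some letter of row j + 1 (field `ascent`). A standard tableau, cut into segments at the
elements of S(α), gives the same kind of matrix, with an ascent after every segment but the last.
Both claims thus reduce to `exists_stripMatrix_iff`.

Necessity: row j has no letter above j, which gives dominance, and each ascent between rows from i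
on costs a box whose letter is not i (`StripMatrix.add_countFrom_le`).

Sufficiency: by induction on the number of rows, a horizontal strip as long as the last part of α is
removed from ν so that all inequalities persist (`exists_stripMatrix_succ`). Its boxes are taken as
low as possible; this keeps dominance because α decreases. A row that is too long for its new bound
must lose boxes, but above the last row of ν there is at most one, because the parts are at least
two (`not_two_long_rows`). For an ascent, the strip takes a box from the last row of ν, and the
induction carries the demand that the preceding strip have a box above that row. -/

namespace MonotoneRibbon

open Finset

/-! ### Removing a horizontal strip -/

/-- Between two sequences of bounds there is a sequence with a prescribed sum that is filled up
from the end. -/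
lemma exists_between_filled_from_end (c b : ℕ → ℕ) (hbc : ∀ i, b i ≤ c i) (n : ℕ) :
    ∀ m, ∑ i ∈ range n, b i ≤ m → m ≤ ∑ i ∈ range n, c i →
    ∃ x : ℕ → ℕ, (∀ i < n, b i ≤ x i) ∧ (∀ i, x i ≤ c i) ∧ (∀ i, n ≤ i → x i = 0) ∧
      ∑ i ∈ range n, x i = m ∧
      ∀ i ≤ n, ∑ q ∈ range i, x q = ∑ q ∈ range i, b q ∨ ∀ q, i ≤ q → q < n → x q = c q := by
  induction n with
  | zero =>
    intro m _ hm
    refine ⟨fun _ => 0, by simp, by simp, by simp, by simp at hm; simp [hm], ?_⟩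
    intro i hi
    right
    omega
  | succ n ih =>
    intro m h1 h2
    rw [sum_range_succ] at h1 h2
    have hb := hbc n
    have hsum : ∑ i ∈ range n, b i ≤ ∑ i ∈ range n, c i := sum_le_sum fun i _ => hbc i
    obtain ⟨x, hx1, hx2, hx3, hx4, hx5⟩ := ih (m - min (c n) (m - ∑ i ∈ range n, b i))
      (by omega) (by omega)
    have hagree : ∀ i ≤ n, ∑ q ∈ range i, (if q = n then min (c n) (m - ∑ i ∈ range n, b i)
        else x q) = ∑ q ∈ range i, x q := by
      intro i hi
      refine sum_congr rfl fun q hq => if_neg ?_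
      have := mem_range.1 hq
      omega
    refine ⟨fun i => if i = n then min (c n) (m - ∑ i ∈ range n, b i) else x i, ?_, ?_, ?_, ?_, ?_⟩
    · intro i hi
      dsimp only
      split_ifs with h
      · subst h; omega
      · exact hx1 i (by omega)
    · intro i
      dsimp only
      split_ifs with h
      · subst h; omega
      · exact hx2 i
    · intro i hi
      dsimp only
      rw [if_neg (by omega)]
      exact hx3 i (by omega)
    · rw [sum_range_succ, hagree n le_rfl, hx4, if_pos rfl]
      omega
    · intro i hi
      rcases Nat.lt_or_ge n i with h | h
      · right; omega
      rw [hagree i h]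
      -- If place n is saturated, the earlier places decide. Otherwise they are left with exactly
      -- the sum of their lower bounds, so they equal these bounds.
      by_cases hc : c n ≤ m - ∑ i ∈ range n, b i
      · rcases hx5 i h with h5 | h5
        · exact Or.inl h5
        · right
          intro q hq hqn
          dsimp only
          split_ifs with hqn'
          · subst hqn'; omega
          · exact h5 q hq (by omega)
      · left
        have heq : ∑ i ∈ range n, b i = ∑ i ∈ range n, x i := by omega
        have := (sum_eq_sum_iff_of_le fun i hi => hx1 i (mem_range.1 hi)).1 heq
        refine sum_congr rfl fun q hq => (this q ?_).symm
        have := mem_range.1 hq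
        exact mem_range.2 (by omega)

lemma sum_range_add_tail_le {ν : ℕ → ℕ} (hν : Antitone ν) {r : ℕ} (hr : 0 < ν r) {i n : ℕ}
    (hi : i ≤ n) (hn : n ≤ r + 1) : ∑ q ∈ range i, ν q + (n - i) ≤ ∑ q ∈ range n, ν q := by
  induction n, hi using Nat.le_induction with
  | base => simp
  | succ n hin ih =>
    rw [sum_range_succ]
    have := ih (by omega)
    have := hν (show n ≤ r by omega)
    omega

lemma sum_range_of_zero {ν : ℕ → ℕ} {r n : ℕ} (h : ∀ i, r < i → ν i = 0) (hn : r < n) :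
    ∑ q ∈ range n, ν q = ∑ q ∈ range (r + 1), ν q := by
  symm
  apply sum_subset
  · exact range_subset_range.2 hn
  · intro i _ hi
    exact h i (by simpa using hi)

/-- From a partition `ν` that dominates `α` one can remove a horizontal strip, as long as the last
part of `α`, with prescribed numbers of boxes in the last row and in one other row. -/
lemma exists_horizontal_strip {α ν : ℕ → ℕ} (hα : Antitone α) (hν : Antitone ν) {r K : ℕ}
    (hr : r ≤ K + 1) (hzero : ∀ i, r < i → ν i = 0)
    (hdom : ∀ i ≤ K + 2, ∑ q ∈ range i, α q ≤ ∑ q ∈ range i, ν q)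
    (htot : ∑ q ∈ range (K + 2), ν q = ∑ q ∈ range (K + 2), α q) {a u v : ℕ}
    (ha : a < r ∨ u = 0) (hu : u + ν (a + 1) ≤ ν a) (hv : v ≤ ν r) (huv : u + v ≤ α (K + 1))
    (hd : ∀ i, a < i → i ≤ r → u + ∑ q ∈ range i, α q ≤ ∑ q ∈ range i, ν q) :
    ∃ x : ℕ → ℕ, (∀ i, x i + ν (i + 1) ≤ ν i) ∧ (∀ i, r < i → x i = 0) ∧
      ∑ i ∈ range (r + 1), x i = α (K + 1) ∧ u ≤ x a ∧ v ≤ x r ∧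
      ∀ i ≤ K + 1, ∑ q ∈ range i, α q + ∑ q ∈ range i, x q ≤ ∑ q ∈ range i, ν q := by
  -- The capacities telescope: the rows from i on can lose at most ν i boxes in a horizontal strip.
  have hcap : ∀ i ≤ r + 1, ∑ q ∈ Ico i (r + 1), (ν q - ν (q + 1)) = ν i := by
    intro i hi
    induction hi using Nat.decreasingInduction with
    | self => simp [hzero]
    | of_succ i hi ih =>
      rw [sum_eq_sum_Ico_succ_bot (by omega), ih]
      have := hν (Nat.le_succ i)
      simp only [Nat.succ_eq_add_one] at this
      omega
  have hbsum : ∀ i ≤ r, ∑ q ∈ range i, (if q = r then v else if q = a then u else 0) =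
      if a < i then u else 0 := by
    intro i hi
    have : ∑ q ∈ range i, (if q = r then v else if q = a then u else 0) =
        ∑ q ∈ range i, (if q = a then u else 0) := by
      refine sum_congr rfl fun q hq => if_neg ?_
      have := mem_range.1 hq
      omega
    rw [this, sum_ite_eq']
    simp
  have hb : ∀ i, (if i = r then v else if i = a then u else 0) ≤ ν i - ν (i + 1) := by
    intro i
    split_ifs with h1 h2
    · subst h1
      rw [hzero (i + 1) (by omega)]
      omega
    · subst h2; omega
    · omega
  have hα0 : α (K + 1) ≤ ν 0 := by
    have := hdom 1 (by omega)
    simp only [sum_range_one] at this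
    exact (hα (Nat.zero_le _)).trans this
  obtain ⟨x, hx1, hx2, hx3, hx4, hx5⟩ := exists_between_filled_from_end
    (fun i => ν i - ν (i + 1)) _ hb (r + 1) (α (K + 1))
    (by rw [sum_range_succ, hbsum r le_rfl, if_pos rfl]; split_ifs <;> omega)
    (by rw [range_eq_Ico, hcap 0 (by omega)]; exact hα0)
  have hx2' : ∀ i, x i + ν (i + 1) ≤ ν i := by
    intro i
    have := hx2 i
    have := hν (Nat.le_succ i)
    simp only [Nat.succ_eq_add_one] at *
    omega
  refine ⟨x, hx2', fun i hi => hx3 i hi, hx4, ?_, ?_, ?_⟩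
  · rcases ha with ha | ha
    · have := hx1 a (by omega)
      rwa [if_neg (by omega), if_pos rfl] at this
    · omega
  · have := hx1 r (by omega)
    rwa [if_pos rfl] at this
  · intro i hi
    rcases Nat.lt_or_ge r i with h | h
    · rw [sum_range_of_zero hzero h, sum_range_of_zero hx3 h, hx4,
        ← sum_range_of_zero hzero (show r < K + 2 by omega), htot, sum_range_succ _ (K + 1)]
      have : ∑ q ∈ range i, α q ≤ ∑ q ∈ range (K + 1), α q :=
        sum_le_sum_of_subset (range_subset_range.2 hi)
      omega
    rcases hx5 i (by omega) with h5 | h5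
    · rw [h5, hbsum i h]
      split_ifs with hai
      · have := hd i hai h
        omega
      · have := hdom i (by omega)
        omega
    -- The rows from i on are saturated and lose ν i boxes together. Dominance at i + 1 and α (K +
    -- 1) ≤ α i then suffice.
    · have h6 : ∑ q ∈ range i, x q + ν i = α (K + 1) := by
        rw [← hx4, ← sum_range_add_sum_Ico x (show i ≤ r + 1 by omega), ← hcap i (by omega)]
        congr 1
        refine sum_congr rfl fun q hq => ?_
        have := mem_Ico.1 hq
        exact (h5 q this.1 this.2).symm
      have h7 := hdom (i + 1) (by omega)
      rw [sum_range_succ, sum_range_succ] at h7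
      have := hα (show i ≤ K + 1 by omega)
      omega

/-! ### Strip matrices and the choice of the last strip -/

/-- The number of `q` with `i ≤ q < K` that satisfy `D`. -/
noncomputable def countFrom (D : ℕ → Prop) (i K : ℕ) : ℕ :=
  open Classical in #{q ∈ Ico i K | D q}

/-- `X j i` is the number of letters `i` in the `j`-th of `k` weakly decreasing segments of a
Yamanouchi word of content `ν`, whose segments have the lengths `α j`, and which has an ascent
after segment `j` whenever `D j`. (Letters are numbered from `0`.) -/
structure StripMatrix (α ν : ℕ → ℕ) (D : ℕ → Prop) (k N : ℕ) (X : ℕ → ℕ → ℕ) : Prop where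
  row_sum : ∀ j < k, ∑ i ∈ range N, X j i = α j
  col_sum : ∀ i, ∑ j ∈ range k, X j i = ν i
  strip : ∀ j < k, ∀ i, ∑ q ∈ range (j + 1), X q (i + 1) ≤ ∑ q ∈ range j, X q i
  ascent : ∀ j, j + 1 < k → D j → ∃ a b, a < b ∧ 0 < X j a ∧ 0 < X (j + 1) b

lemma countFrom_le (D : ℕ → Prop) (i K : ℕ) : countFrom D i K ≤ K - i := by
  classical
  unfold countFrom
  exact (card_filter_le _ _).trans (by simp)

lemma countFrom_succ (D : ℕ → Prop) [DecidablePred D] {i K : ℕ} (h : i ≤ K) :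
    countFrom D i (K + 1) = countFrom D i K + if D K then 1 else 0 := by
  classical
  unfold countFrom
  rw [← Finset.insert_Ico_right_eq_Ico_add_one h, filter_insert]
  split_ifs with h1
  · rw [card_insert_of_notMem (by simp)]
  · simp

lemma countFrom_of_le (D : ℕ → Prop) {i K : ℕ} (h : K ≤ i) : countFrom D i K = 0 := by
  have := countFrom_le D i K
  omega

lemma mul_le_sum_Ico {α : ℕ → ℕ} (hα : Antitone α) (i n : ℕ) :
    α n * (n - i) ≤ ∑ q ∈ Ico i n, α q := by
  rw [mul_comm]
  have := card_nsmul_le_sum (Ico i n) α (α n) fun q hq => hα (mem_Ico.1 hq).2.le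
  simpa using this

/-- Here y is the length of a row that breaks its bound A, a sum of h + 1 parts that are at least m;
hence y ≥ m + 1 + h. T is the size of g rows of length at least y, and the last hypothesis is the
room that another long row, g rows higher, leaves below itself. -/
lemma not_two_long_rows {m g h c A y T : ℕ} (hm : 2 ≤ m) (hg : 1 ≤ g) (hA : m * (h + 1) ≤ A)
    (hc : c ≤ h) (hy : A < y + c) (hT : g * y ≤ T) (hT' : T + 1 ≤ m + g + h) : False := by
  have h1 : m + 1 + h ≤ y := by nlinarith
  nlinarith

/-- The strip that is removed in the induction step of `exists_stripMatrix_succ`. -/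
lemma exists_last_strip {α ν : ℕ → ℕ} (hα : Antitone α) (hν : Antitone ν) {r K f : ℕ} {c : ℕ → ℕ}
    {e : Prop} (hm : 2 ≤ α (K + 1)) (hr : r ≤ K + 1) (hνr : 0 < ν r) (hzero : ∀ i, r < i → ν i = 0)
    (hdom : ∀ i ≤ K + 2, ∑ q ∈ range i, α q ≤ ∑ q ∈ range i, ν q)
    (htot : ∑ q ∈ range (K + 2), ν q = ∑ q ∈ range (K + 2), α q) (hf : f ≤ 1)
    (hc : ∀ i, c i ≤ K - i)
    (hbd : ∀ i ≤ K, ν i + (c i + f) ≤ ∑ q ∈ Ico i (K + 1), α q + α (K + 1))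
    (he : e → 0 < r ∧ ν r < ν (r - 1) ∧
      (r ≤ K → ν r + (c r + f) + 1 ≤ ∑ q ∈ Ico r (K + 1), α q + α (K + 1)) ∧
      (r = K + 1 → ν r + 1 ≤ α (K + 1))) :
    ∃ x : ℕ → ℕ, (∀ i, x i + ν (i + 1) ≤ ν i) ∧ (∀ i, r < i → x i = 0) ∧
      ∑ i ∈ range (r + 1), x i = α (K + 1) ∧
      (∀ i ≤ K + 1, ∑ q ∈ range i, α q + ∑ q ∈ range i, x q ≤ ∑ q ∈ range i, ν q) ∧
      (∀ i < r, ν i + c i ≤ ∑ q ∈ Ico i (K + 1), α q + x i) ∧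
      (r ≤ K → ν r + (c r + f) ≤ ∑ q ∈ Ico r (K + 1), α q + x r) ∧
      f ≤ x r ∧ (r = K + 1 → x r = ν r) ∧ (e → ∃ i < r, 0 < x i) := by
  have hA : ∀ i ≤ K + 1, ∑ q ∈ range i, α q + ∑ q ∈ Ico i (K + 1), α q =
      ∑ q ∈ range (K + 1), α q := fun i hi => sum_range_add_sum_Ico α hi
  have hA2 : ∀ i, 2 * (K + 1 - i) ≤ ∑ q ∈ Ico i (K + 1), α q := fun i =>
    (Nat.mul_le_mul_right _ hm).trans (mul_le_sum_Ico hα i (K + 1))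
  have hAm : ∀ i, α (K + 1) * (K + 1 - i) ≤ ∑ q ∈ Ico i (K + 1), α q := fun i =>
    mul_le_sum_Ico hα i (K + 1)
  have htot' : ∑ q ∈ range (r + 1), ν q = ∑ q ∈ range (K + 1), α q + α (K + 1) := by
    rw [← sum_range_of_zero hzero (show r < K + 2 by omega), htot, sum_range_succ]
  -- What row r must lose: enough to restore its bound, plus f, which provides the box for the
  -- ascent and the slack demanded by the next induction step. If r = K + 1 the row must vanish, as
  -- only rows 0, …, K may remain.
  obtain ⟨v, hv⟩ : ∃ v, v = if r ≤ K then f + (ν r + c r - ∑ q ∈ Ico r (K + 1), α q) else ν r :=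
    ⟨_, rfl⟩
  have hvν : v ≤ ν r := by
    rw [hv]
    have := hc r
    have := hA2 r
    split_ifs <;> omega
  have hvm : v ≤ α (K + 1) := by
    rw [hv]
    split_ifs with h
    · have := hbd r h; omega
    · have h1 := hdom (K + 1) (by omega)
      have hrK : r = K + 1 := by omega
      subst hrK
      rw [sum_range_succ] at htot'
      omega
  -- It suffices to name one row a above r that loses u boxes (or u = 0), if all other rows above r
  -- meet their new bounds already.
  have key : ∀ a u, (a < r ∨ u = 0) → u + ν (a + 1) ≤ ν a → u + v ≤ α (K + 1) →
      (∀ i, a < i → i ≤ r → u + ∑ q ∈ range i, α q ≤ ∑ q ∈ range i, ν q) →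
      (∀ i < r, i ≠ a → ν i + c i ≤ ∑ q ∈ Ico i (K + 1), α q) →
      (a < r → ν a + c a ≤ ∑ q ∈ Ico a (K + 1), α q + u) → (e → a < r ∧ 0 < u) →
      ∃ x : ℕ → ℕ, (∀ i, x i + ν (i + 1) ≤ ν i) ∧ (∀ i, r < i → x i = 0) ∧
      ∑ i ∈ range (r + 1), x i = α (K + 1) ∧
      (∀ i ≤ K + 1, ∑ q ∈ range i, α q + ∑ q ∈ range i, x q ≤ ∑ q ∈ range i, ν q) ∧
      (∀ i < r, ν i + c i ≤ ∑ q ∈ Ico i (K + 1), α q + x i) ∧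
      (r ≤ K → ν r + (c r + f) ≤ ∑ q ∈ Ico r (K + 1), α q + x r) ∧
      f ≤ x r ∧ (r = K + 1 → x r = ν r) ∧ (e → ∃ i < r, 0 < x i) := by
    intro a u h1 h2 h3 h4 h5 h6 h7
    obtain ⟨x, hx1, hx2, hx3, hx4, hx5, hx6⟩ := exists_horizontal_strip hα hν hr hzero hdom htot
      h1 h2 hvν h3 h4
    have hxr := hx1 r
    rw [hzero (r + 1) (by omega)] at hxr
    refine ⟨x, hx1, hx2, hx3, hx6, ?_, ?_, ?_, ?_, fun h => ⟨a, (h7 h).1, (h7 h).2.trans_le hx4⟩⟩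
    · intro i hi
      by_cases hia : i = a
      · subst hia
        have := h6 hi
        omega
      · have := h5 i hi hia; omega
    · intro hrK
      rw [if_pos hrK] at hv
      omega
    · split_ifs at hv <;> omega
    · intro hrK
      rw [if_neg (by omega)] at hv
      omega
  by_cases hex : ∃ a < r, ∑ q ∈ Ico a (K + 1), α q < ν a + c a
  · obtain ⟨a, har, ha⟩ := hex
    obtain ⟨u, hu⟩ : ∃ u, u + ∑ q ∈ Ico a (K + 1), α q = ν a + c a :=
      ⟨_, Nat.sub_add_cancel ha.le⟩
    -- By dominance before row a, at most α (K + 1) + c a - u boxes lie below row a.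
    have hua : u + ∑ q ∈ range (r + 1), ν q ≤ ∑ q ∈ range (a + 1), ν q + α (K + 1) + c a := by
      have := hdom a (by omega)
      have := hA a (by omega)
      rw [sum_range_succ _ a]
      omega
    have hrest : ∀ i, a < i → i ≤ r → u + ∑ q ∈ range (r + 1), ν q + (i - (a + 1)) ≤
        ∑ q ∈ range i, ν q + α (K + 1) + c a := by
      intro i hai hir
      have := sum_range_add_tail_le hν hνr (show a + 1 ≤ i by omega) (show i ≤ r + 1 by omega)
      omega
    -- A second long row below a would not fit into this number of boxes.
    have huniq : ∀ i ≤ r, i ≤ K → a < i → ν i + c i ≤ ∑ q ∈ Ico i (K + 1), α q := by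
      intro i hir hiK hai
      by_contra hcon
      push Not at hcon
      have hT : (i - a) * ν i ≤ ∑ q ∈ Ico (a + 1) (i + 1), ν q := by
        have := card_nsmul_le_sum (Ico (a + 1) (i + 1)) ν (ν i) fun q hq =>
          hν (by have := (mem_Ico.1 hq).2; omega)
        simpa using this
      have hT' := sum_range_add_sum_Ico ν (show a + 1 ≤ i + 1 by omega)
      have hle : ∑ q ∈ range (i + 1), ν q ≤ ∑ q ∈ range (r + 1), ν q :=
        sum_le_sum_of_subset (range_subset_range.2 (by omega))
      have hca := hc a
      refine not_two_long_rows (h := K - i) hm (show 1 ≤ i - a by omega) ?_ (hc i) hcon hT ?_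
      · have := hAm i
        rwa [show K + 1 - i = K - i + 1 by omega] at this
      · omega
    refine key a u (Or.inl har) ?_ ?_ ?_ ?_ (fun _ => by omega) fun _ => ⟨har, by omega⟩
    -- Row a can spare u boxes: as parts are at least two, its bound is at least α (K + 1) + 2 (K -
    -- a), which absorbs c a twice.
    · have h1 : ν (a + 1) + ∑ q ∈ range (a + 1), ν q ≤ ∑ q ∈ range (r + 1), ν q := by
        rw [add_comm, ← sum_range_succ]
        exact sum_le_sum_of_subset (range_subset_range.2 (by omega))
      have h2 := hAm a
      rw [show K + 1 - a = K - a + 1 by omega, mul_add, mul_one] at h2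
      have h3 := Nat.mul_le_mul_right (K - a) hm
      have h4 := hc a
      omega
    · by_cases hrK : r ≤ K
      · have h1 := huniq r le_rfl hrK har
        have h2 := hbd a (by omega)
        rw [if_pos hrK] at hv
        omega
      · have h1 := hrest r har le_rfl
        have h2 := hc a
        rw [if_neg hrK] at hv
        rw [sum_range_succ] at h1
        omega
    · intro i hai hir
      have h1 := hrest i hai hir
      have h2 := hc a
      have h3 := hA i (by omega)
      have h4 := hA2 i
      omega
    · intro i hir hia
      rcases Nat.lt_or_gt_of_ne hia with h | h
      -- A long row i above a is excluded by the same count, now for the boxes below row i.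
      · by_contra hcon
        push Not at hcon
        have hT : (a - i) * ν a ≤ ∑ q ∈ Ico (i + 1) (a + 1), ν q := by
          have := card_nsmul_le_sum (Ico (i + 1) (a + 1)) ν (ν a) fun q hq =>
            hν (by have := (mem_Ico.1 hq).2; omega)
          simpa using this
        have hT' := sum_range_add_sum_Ico ν (show i + 1 ≤ a + 1 by omega)
        have hle : ∑ q ∈ range (a + 1), ν q ≤ ∑ q ∈ range (r + 1), ν q :=
          sum_le_sum_of_subset (range_subset_range.2 (by omega))
        have hci := hc i
        have h1 := hdom i (by omega)
        have h2 := hA i (by omega)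
        rw [sum_range_succ _ i] at hT'
        refine not_two_long_rows (h := K - a) hm (show 1 ≤ a - i by omega) ?_ (hc a) ha hT ?_
        · have := hAm a
          rwa [show K + 1 - a = K - a + 1 by omega] at this
        · omega
      · exact huniq i hir.le (by omega) h
  · push Not at hex
    -- No row is long. The demand e is met by one box of row r - 1, which `he` makes available.
    by_cases hee : e
    · obtain ⟨h1, h2, h3, h4⟩ := he hee
      have hr1 : r - 1 + 1 = r := by omega
      refine key (r - 1) 1 (Or.inl (by omega)) (by rw [hr1]; omega) ?_ ?_ (fun i hi _ => hex i hi)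
        (fun h => (hex (r - 1) h).trans (Nat.le_succ _)) fun _ => ⟨by omega, one_pos⟩
      · by_cases hrK : r ≤ K
        · have := h3 hrK
          rw [if_pos hrK] at hv
          omega
        · have := h4 (by omega)
          rw [if_neg hrK] at hv
          omega
      · intro i hi1 hi2
        have hir : i = r := by omega
        subst hir
        have h5 := hA i hr
        rw [sum_range_succ] at htot'
        by_cases hrK : i ≤ K
        · have := h3 hrK
          omega
        · have := h4 (by omega)
          omega
    · refine key r 0 (Or.inr rfl) ?_ (by omega) (fun i hi hi' => by omega) (fun i hi _ => hex i hi)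
        (fun h => absurd h (lt_irrefl r)) fun h => absurd h hee
      have := hν (Nat.le_succ r)
      simpa using this

/-- A letter i + 1 needs a letter i in a strictly earlier row, so each row can introduce only one
new letter. -/
lemma StripMatrix.eq_zero {α ν : ℕ → ℕ} {D : ℕ → Prop} {k N : ℕ} {X : ℕ → ℕ → ℕ}
    (h : StripMatrix α ν D k N X) : ∀ i, ∀ j < k, j < i → X j i = 0 := by
  intro i
  induction i with
  | zero => intro j _ hj; omega
  | succ i ih =>
    intro j hj hji
    have h1 := h.strip j hj i
    have h2 : ∑ q ∈ range j, X q i = 0 := sum_eq_zero fun q hq => by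
      have := mem_range.1 hq
      exact ih q (by omega) (by omega)
    rw [sum_range_succ] at h1
    omega

lemma StripMatrix.le {α ν : ℕ → ℕ} {D : ℕ → Prop} {k N : ℕ} {X : ℕ → ℕ → ℕ}
    (h : StripMatrix α ν D k N X) {j : ℕ} (hj : j < k) (i : ℕ) : X j i ≤ ν i := by
  rw [← h.col_sum i]
  exact single_le_sum (f := fun j => X j i) (fun _ _ => Nat.zero_le _) (mem_range.2 hj)

/-- Adding one more horizontal strip. -/
lemma StripMatrix.snoc {α ν x : ℕ → ℕ} {D : ℕ → Prop} {K N : ℕ} {X : ℕ → ℕ → ℕ}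
    (h : StripMatrix α (fun i => ν i - x i) D (K + 1) N X)
    (hx : ∀ i, x i + ν (i + 1) ≤ ν i) (hsum : ∑ i ∈ range N, x i = α (K + 1))
    (hD : D K → ∃ a b, a < b ∧ 0 < X K a ∧ 0 < x b) :
    StripMatrix α ν D (K + 2) N fun j i => if j = K + 1 then x i else X j i := by
  have hlt : ∀ n ≤ K + 1, ∀ i, ∑ j ∈ range n, (if j = K + 1 then x i else X j i) =
      ∑ j ∈ range n, X j i := by
    intro n hn i
    refine sum_congr rfl fun q hq => if_neg ?_
    have := mem_range.1 hq
    omega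
  have hall : ∀ i, ∑ j ∈ range (K + 2), (if j = K + 1 then x i else X j i) = ν i := by
    intro i
    rw [sum_range_succ, hlt _ le_rfl, if_pos rfl, h.col_sum]
    have := hx i
    omega
  constructor
  · intro j hj
    by_cases hjK : j = K + 1
    · simpa [hjK] using hsum
    · simpa [hjK] using h.row_sum j (by omega)
  · exact hall
  · intro j hj i
    by_cases hjK : j = K + 1
    · subst hjK
      rw [hall, hlt _ le_rfl, h.col_sum]
      have := hx i
      omega
    · rw [hlt _ (by omega), hlt _ (by omega)]
      exact h.strip j (by omega) i
  · intro j hj hDj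
    by_cases hjK : j = K
    · subst hjK
      obtain ⟨a, b, hab, ha, hb⟩ := hD hDj
      exact ⟨a, b, hab, by simpa using ha, by simpa using hb⟩
    · obtain ⟨a, b, hab, ha, hb⟩ := h.ascent j (by omega) hDj
      refine ⟨a, b, hab, ?_, ?_⟩
      · rwa [if_neg (by omega)]
      · rwa [if_neg (by omega)]

/-! ### Sufficiency of the inequalities -/

lemma exists_stripMatrix_succ {α : ℕ → ℕ} (hα : Antitone α) (D : ℕ → Prop) (N K : ℕ)
    (hN : K + 1 ≤ N) (h2 : ∀ i ≤ K, 2 ≤ α i) (ν : ℕ → ℕ) (hν : Antitone ν)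
    (hzero : ∀ i, K < i → ν i = 0)
    (htot : ∑ q ∈ range (K + 1), ν q = ∑ q ∈ range (K + 1), α q)
    (hdom : ∀ i ≤ K + 1, ∑ q ∈ range i, α q ≤ ∑ q ∈ range i, ν q)
    (hbd : ∀ i ≤ K, ν i + countFrom D i K ≤ ∑ q ∈ Ico i (K + 1), α q) (e : Prop) (r : ℕ)
    (he : e → 0 < r ∧ ν (r + 1) = 0 ∧ ν r < ν (r - 1) ∧
      (r ≤ K → ν r + countFrom D r K + 1 ≤ ∑ q ∈ Ico r (K + 1), α q)) :
    ∃ X, StripMatrix α ν D (K + 1) N X ∧ (e → ∃ a < r, 0 < X K a) := by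
  classical
  induction K generalizing ν e r with
  | zero =>
    simp only [zero_add, sum_range_one] at htot
    have := h2 0 le_rfl
    refine ⟨fun _ i => if i = 0 then α 0 else 0, ⟨?_, ?_, ?_, ?_⟩, ?_⟩
    · intro j hj
      obtain rfl : j = 0 := by omega
      simp
      omega
    · intro i
      rcases Nat.eq_zero_or_pos i with rfl | hi
      · simp [htot]
      · simp [hi.ne', hzero i hi]
    · intro j hj i
      obtain rfl : j = 0 := by omega
      simp
    · intro j hj
      omega
    · intro h
      exact ⟨0, (he h).1, by simp; omega⟩
  | succ K ih =>
    have hm := h2 (K + 1) le_rfl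
    -- The case where r is the last nonempty row of ν; only here does the demand e constrain the
    -- strip.
    have main : ∀ (e : Prop) (r : ℕ), 0 < ν r → ν (r + 1) = 0 →
        (e → 0 < r ∧ ν r < ν (r - 1) ∧
          (r ≤ K + 1 → ν r + countFrom D r (K + 1) + 1 ≤ ∑ q ∈ Ico r (K + 2), α q)) →
        ∃ X, StripMatrix α ν D (K + 2) N X ∧ (e → ∃ a < r, 0 < X (K + 1) a) := by
      intro e r hr hr1 he
      have hrK : r ≤ K + 1 := by
        by_contra hcon
        have := hzero r (by omega)
        omega
      have hzr : ∀ i, r < i → ν i = 0 := fun i hi => by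
        have := hν (show r + 1 ≤ i by omega)
        omega
      have hA : ∀ i ≤ K + 1, ∑ q ∈ Ico i (K + 2), α q = ∑ q ∈ Ico i (K + 1), α q + α (K + 1) :=
        fun i hi => sum_Ico_succ_top hi _
      have hf : (if D K then 1 else 0) ≤ 1 := by split_ifs <;> omega
      obtain ⟨x, hx1, hx2, hx3, hx4, hx5, hx6, hx7, hx8, hx9⟩ := exists_last_strip hα hν
        (c := fun i => countFrom D i K) (e := e) hm hrK hr hzr hdom htot hf
        (fun i => countFrom_le D i K)
        (fun i hi => by
          rw [← countFrom_succ D hi, ← hA i (by omega)]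
          exact hbd i (by omega))
        (fun h => by
          obtain ⟨h1, h2, h3⟩ := he h
          refine ⟨h1, h2, fun h4 => ?_, fun h4 => ?_⟩
          · rw [← countFrom_succ D h4, ← hA r hrK]
            exact h3 hrK
          · have := h3 hrK
            rw [hA r hrK, h4, countFrom_of_le D le_rfl] at this
            simp at this
            rw [h4]
            omega)
      have hxν : ∀ i, x i ≤ ν i := fun i => (Nat.le_add_right _ _).trans (hx1 i)
      have hsub : ∀ n, ∑ q ∈ range n, (ν q - x q) + ∑ q ∈ range n, x q = ∑ q ∈ range n, ν q := by
        intro n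
        rw [← sum_add_distrib]
        exact sum_congr rfl fun q _ => Nat.sub_add_cancel (hxν q)
      -- The strip empties row K + 1, since the remaining K + 1 strips reach only the rows 0, …, K.
      have hxK : x (K + 1) = ν (K + 1) := by
        rcases hrK.lt_or_eq with h | h
        · rw [hx2 _ h, hzr _ h]
        · rw [← h]; exact hx8 h
      have hxs : ∑ q ∈ range (K + 1), x q + ν (K + 1) = α (K + 1) := by
        rw [← hxK, ← sum_range_succ, sum_range_of_zero hx2 (by omega), hx3]
      obtain ⟨X, hX, hXe⟩ := ih (by omega) (fun i hi => h2 i (by omega)) (fun i => ν i - x i)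
        (antitone_nat_of_succ_le fun i => by have := hx1 i; omega)
        (fun i hi => by
          rcases Nat.lt_or_ge (K + 1) i with h | h
          · simp [hzero i h]
          · obtain rfl : i = K + 1 := by omega
            simp [hxK])
        (by
          have := hsub (K + 1)
          rw [sum_range_succ ν, sum_range_succ α] at htot
          omega)
        (fun i hi => by
          have := hsub i
          have := hx4 i hi
          omega)
        (fun i hi => by
          rcases Nat.lt_trichotomy i r with h | h | h
          · have := hx5 i h
            have := hxν i
            omega
          · subst h
            have := hx6 hi
            have := hxν i
            omega
          · have h3 := countFrom_le D i K
            have h4 := (Nat.mul_le_mul_right (K + 1 - i) hm).trans (mul_le_sum_Ico hα i (K + 1))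
            rw [hzr i h]
            omega)
        -- The new demand: if D K holds, the strip just removed has a box in row r, so the preceding
        -- one needs a box above row r. Removing that box left row r shorter than row r - 1 and, by
        -- the term f, its bound with slack one.
        (D K) r
        (fun hDK => by
          rw [if_pos hDK] at hx6 hx7
          -- If ν had a single row, its bound would leave no room for the ascent.
          have hr0 : 0 < r := by
            by_contra hcon
            obtain rfl : r = 0 := by omega
            have h3 := hbd 0 (by omega)
            rw [countFrom_succ D (by omega), if_pos hDK, ← range_eq_Ico, ← htot,
              sum_range_of_zero hzr (by omega)] at h3
            simp at h3
          refine ⟨hr0, by simp [hr1], ?_, fun h => ?_⟩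
          · have h3 := hx1 (r - 1)
            rw [show r - 1 + 1 = r by omega] at h3
            have := hxν r
            omega
          · have := hx6 h
            have := hxν r
            have h3 := countFrom_le D r K
            have h4 := (Nat.mul_le_mul_right (K + 1 - r) hm).trans (mul_le_sum_Ico hα r (K + 1))
            omega)
      refine ⟨_, hX.snoc hx1 ?_ ?_, ?_⟩
      · rw [sum_range_of_zero hx2 (by omega), hx3]
      · intro hDK
        obtain ⟨a, ha, hXa⟩ := hXe hDK
        rw [if_pos hDK] at hx7
        exact ⟨a, r, ha, hXa, by omega⟩
      · simpa using hx9
    -- If e holds but row r is empty, the demand is automatic, since every box lies above row r.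
    by_cases hcase : e ∧ 0 < ν r
    · exact main e r hcase.2 (he hcase.1).2.1 fun h => ⟨(he h).1, (he h).2.2⟩
    · have hν0 : 0 < ν 0 := by
        have h3 := hdom 1 (by omega)
        have h4 := h2 0 (by omega)
        simp only [sum_range_one] at h3
        omega
      have hgr : 0 < ν (Nat.findGreatest (fun i => 0 < ν i) (K + 1)) :=
        Nat.findGreatest_spec (P := fun i => 0 < ν i) (Nat.zero_le (K + 1)) hν0
      have hgr1 : ν (Nat.findGreatest (fun i => 0 < ν i) (K + 1) + 1) = 0 := by
        by_contra hcon
        rcases Nat.lt_or_ge (K + 1) (Nat.findGreatest (fun i => 0 < ν i) (K + 1) + 1) with h | h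
        · exact hcon (hzero _ h)
        · have := Nat.le_findGreatest (P := fun i => 0 < ν i) h (Nat.pos_of_ne_zero hcon)
          omega
      obtain ⟨X, hX, -⟩ := main False _ hgr hgr1 False.elim
      refine ⟨X, hX, fun h => ?_⟩
      have hrow := hX.row_sum (K + 1) (by omega)
      have : ∑ i ∈ range N, X (K + 1) i ≠ 0 := by omega
      obtain ⟨a, -, ha⟩ := exists_ne_zero_of_sum_ne_zero this
      refine ⟨a, ?_, Nat.pos_of_ne_zero ha⟩
      by_contra hcon
      have h3 := hX.le (show K + 1 < K + 2 by omega) a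
      have h4 := hν (show r ≤ a by omega)
      have h5 : ν r = 0 := by
        by_contra h5
        exact hcase ⟨h, Nat.pos_of_ne_zero h5⟩
      omega

/-! ### Necessity of the inequalities -/

/-- By `StripMatrix.eq_zero`, the first i segments use only letters below i. -/
lemma StripMatrix.dominated {α ν : ℕ → ℕ} {D : ℕ → Prop} {k N : ℕ} {X : ℕ → ℕ → ℕ}
    (h : StripMatrix α ν D k N X) {i : ℕ} (hi : i ≤ k) :
    ∑ q ∈ range i, α q ≤ ∑ q ∈ range i, ν q := by
  have h1 : ∑ q ∈ range i, α q = ∑ j ∈ range i, ∑ q ∈ range N, X j q :=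
    sum_congr rfl fun j hj => (h.row_sum j ((mem_range.1 hj).trans_le hi)).symm
  have h2 : ∀ j ∈ range i, ∑ q ∈ range N, X j q ≤ ∑ q ∈ range i, X j q := by
    intro j hj
    have hj := mem_range.1 hj
    apply sum_le_sum_of_ne_zero
    intro q _ hq
    by_contra hcon
    exact hq (h.eq_zero q j (by omega) (by have := mt mem_range.2 hcon; omega))
  rw [h1]
  refine (sum_le_sum h2).trans ?_
  rw [sum_comm]
  refine sum_le_sum fun q _ => ?_
  rw [← h.col_sum q]
  exact sum_le_sum_of_subset (range_subset_range.2 hi)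

lemma StripMatrix.enlarge {α ν : ℕ → ℕ} {D : ℕ → Prop} {k N N' : ℕ} {X : ℕ → ℕ → ℕ}
    (h : StripMatrix α ν D k N X) (hN : N ≤ N') (hzero : ∀ i, N ≤ i → ν i = 0) :
    StripMatrix α ν D k N' X := by
  refine ⟨fun j hj => ?_, h.col_sum, h.strip, h.ascent⟩
  rw [← h.row_sum j hj]
  symm
  refine sum_subset (range_subset_range.2 hN) fun i _ hi => ?_
  have h1 := h.le hj i
  have h2 := hzero i (by simpa using hi)
  omega

/-- An ascent a < b from row n to row n + 1 has a < i or i < b. Charge it to a letter below i in row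
n or to a letter above i in row n + 1; no box is charged twice. The letter i occurs only in the rows
from i on, whose other boxes are at least as many as the ascents. -/
lemma StripMatrix.add_countFrom_le {α ν : ℕ → ℕ} {D : ℕ → Prop} {k N : ℕ} {X : ℕ → ℕ → ℕ}
    (h : StripMatrix α ν D k N X) {i : ℕ} (hi : i < k) (hkN : k ≤ N) :
    ν i + countFrom D i (k - 1) ≤ ∑ q ∈ Ico i k, α q := by
  classical
  obtain ⟨K, rfl⟩ : ∃ K, k = K + 1 := ⟨k - 1, by omega⟩
  have hiN : i < N := by omega
  have hrow : ∀ j < K + 1, ∑ q ∈ range i, X j q + X j i + ∑ q ∈ Ico (i + 1) N, X j q = α j := by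
    intro j hj
    rw [← h.row_sum j hj, ← sum_range_succ, sum_range_add_sum_Ico _ (by omega)]
  -- The last summand on the left keeps the letters below i of row n in reserve, to pay for the
  -- ascent after row n.
  have key : ∀ n, i ≤ n → n ≤ K → ∑ j ∈ Ico i (n + 1), X j i + countFrom D i n +
      ∑ q ∈ range i, X n q ≤ ∑ q ∈ Ico i (n + 1), α q := by
    intro n hin
    induction n, hin using Nat.le_induction with
    | base =>
      intro hiK
      have := hrow i hi
      rw [countFrom_of_le D le_rfl]
      simp
      omega
    | succ n hin ih =>
      intro hn
      have h1 := ih (by omega)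
      have h2 := hrow (n + 1) (by omega)
      rw [sum_Ico_succ_top (show i ≤ n + 1 by omega), sum_Ico_succ_top (show i ≤ n + 1 by omega),
        countFrom_succ D hin]
      split_ifs with hD
      · have h3 : 0 < ∑ q ∈ range i, X n q + ∑ q ∈ Ico (i + 1) N, X (n + 1) q := by
          obtain ⟨a, b, hab, ha, hb⟩ := h.ascent n (by omega) hD
          rcases Nat.lt_or_ge a i with hai | hai
          · have := single_le_sum (f := fun q => X n q) (fun _ _ => Nat.zero_le _)
              (mem_range.2 hai)
            omega
          · by_cases hbN : b < N
            · have := single_le_sum (f := fun q => X (n + 1) q) (fun _ _ => Nat.zero_le _)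
                (mem_Ico.2 (⟨by omega, hbN⟩ : i + 1 ≤ b ∧ b < N))
              omega
            · have := h.eq_zero b (n + 1) (by omega) (by omega)
              omega
        omega
      · omega
  have hcol : ν i = ∑ j ∈ Ico i (K + 1), X j i := by
    rw [← h.col_sum i, ← sum_range_add_sum_Ico (fun j => X j i) hi.le]
    simp only [Nat.add_eq_right]
    exact sum_eq_zero fun j hj => h.eq_zero i j (by have := mem_range.1 hj; omega) (mem_range.1 hj)
  have := key K (by omega) le_rfl
  rw [hcol]
  simp only [Nat.add_sub_cancel]
  omega

/-- For a weakly decreasing `α` with parts at least two, the strip matrices are characterized by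
inequalities. -/
theorem exists_stripMatrix_iff {α ν : ℕ → ℕ} (hα : Antitone α) (hν : Antitone ν) {D : ℕ → Prop}
    {k N : ℕ} (h2 : ∀ i < k, 2 ≤ α i) (hα0 : ∀ i, k ≤ i → α i = 0) (hkN : k ≤ N)
    (hzero : ∀ i, N ≤ i → ν i = 0)
    (htot : ∑ q ∈ range N, ν q = ∑ q ∈ range N, α q) :
    (∃ X, StripMatrix α ν D k N X) ↔ (∀ i, ∑ q ∈ range i, α q ≤ ∑ q ∈ range i, ν q) ∧
      ∀ i < k, ν i + countFrom D i (k - 1) ≤ ∑ q ∈ Ico i k, α q := by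
  have htail : ∀ n, k ≤ n → ∑ q ∈ range n, α q = ∑ q ∈ range k, α q := fun n hn => by
    symm
    refine sum_subset (range_subset_range.2 hn) fun i _ hi => hα0 i (by simpa using hi)
  constructor
  · rintro ⟨X, hX⟩
    refine ⟨fun i => ?_, fun i hi => hX.add_countFrom_le hi hkN⟩
    rcases Nat.le_total i k with h | h
    · exact hX.dominated h
    · rw [htail i h]
      exact (hX.dominated le_rfl).trans (sum_le_sum_of_subset (range_subset_range.2 h))
  · rintro ⟨hdom, hbd⟩
    have hz : ∀ i, k ≤ i → ν i = 0 := by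
      intro i hi
      by_cases hiN : i < N
      · have h1 := hdom k
        rw [← htail N hkN, ← htot, ← sum_range_add_sum_Ico ν hkN] at h1
        have h3 := single_le_sum (f := ν) (fun _ _ => Nat.zero_le _) (mem_Ico.2 ⟨hi, hiN⟩)
        omega
      · exact hzero i (by omega)
    have htot' : ∑ q ∈ range k, ν q = ∑ q ∈ range k, α q := by
      rw [← htail N hkN, ← htot]
      exact sum_subset (range_subset_range.2 hkN) fun i _ hi => hz i (by simpa using hi)
    rcases Nat.eq_zero_or_pos k with hk | hk
    · subst hk
      exact ⟨fun _ _ => 0, by simp, fun i => by simp [hz], by simp, by simp⟩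
    · obtain ⟨K, rfl⟩ : ∃ K, k = K + 1 := ⟨k - 1, by omega⟩
      obtain ⟨X, hX, -⟩ := exists_stripMatrix_succ hα D N K hkN (fun i hi => h2 i (by omega)) ν hν
        (fun i hi => hz i hi) htot' (fun i _ => hdom i) (fun i hi => hbd i (by omega)) False 0
        False.elim
      exact ⟨X, hX⟩

/-! ### Row lengths and the geometry of ribbons -/

lemma lt_colLen_zero_iff {α : YoungDiagram} {i : ℕ} : i < α.colLen 0 ↔ 0 < α.rowLen i := by
  rw [← YoungDiagram.mem_iff_lt_colLen, YoungDiagram.mem_iff_lt_rowLen]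

lemma rowLen_eq_zero {α : YoungDiagram} {i : ℕ} (h : α.colLen 0 ≤ i) : α.rowLen i = 0 := by
  have := (lt_colLen_zero_iff (α := α) (i := i)).not
  omega

lemma antitone_rowLen (α : YoungDiagram) : Antitone α.rowLen := fun i j h => α.rowLen_anti i j h

lemma card_eq_sum_rowLen (α : YoungDiagram) {n : ℕ} (hn : α.colLen 0 ≤ n) :
    α.card = ∑ i ∈ range n, α.rowLen i := by
  unfold YoungDiagram.card
  rw [card_eq_sum_card_fiberwise (f := Prod.fst) (t := range n)]
  · refine sum_congr rfl fun i _ => ?_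
    rw [YoungDiagram.rowLen_eq_card]
    rfl
  · rintro ⟨i, j⟩ hc
    have hc : (i, j) ∈ α := hc
    have := YoungDiagram.mem_iff_lt_rowLen.1 hc
    have := (lt_colLen_zero_iff (α := α) (i := i)).2 (by omega)
    simp
    omega

lemma mem_skewCells {lam mu : YoungDiagram} {i j : ℕ} :
    (i, j) ∈ skewCells lam mu ↔ mu.rowLen i ≤ j ∧ j < lam.rowLen i := by
  simp [skewCells, YoungDiagram.mem_iff_lt_rowLen]
  tauto

namespace IsRibbonWithRows

variable {α lam mu : YoungDiagram}

lemma rowLen_le (h : IsRibbonWithRows α lam mu) (i : ℕ) : mu.rowLen i ≤ lam.rowLen i := by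
  by_contra hcon
  have h1 : (i, lam.rowLen i) ∈ mu := YoungDiagram.mem_iff_lt_rowLen.2 (by omega)
  have h2 : (i, lam.rowLen i) ∈ lam := h.contained h1
  have := YoungDiagram.mem_iff_lt_rowLen.1 h2
  omega

lemma add_rowLen (h : IsRibbonWithRows α lam mu) (i : ℕ) :
    mu.rowLen i + α.rowLen i = lam.rowLen i := by
  have := h.rowLen_le i
  have := h.rows i
  omega

lemma lt_of_mem (h : IsRibbonWithRows α lam mu) {i j : ℕ} (hc : (i, j) ∈ skewCells lam mu) :
    i < α.colLen 0 := by
  rw [mem_skewCells] at hc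
  have := h.add_rowLen i
  exact lt_colLen_zero_iff.2 (by omega)

/-- Two columns shared by rows i and i + 1 would contain a square. -/
lemma rowLen_succ_le (h : IsRibbonWithRows α lam mu) (i : ℕ) :
    lam.rowLen (i + 1) ≤ mu.rowLen i + 1 := by
  by_contra hcon
  have h1 := antitone_rowLen lam (Nat.le_succ i)
  have h2 := antitone_rowLen mu (Nat.le_succ i)
  simp only [Nat.succ_eq_add_one] at h1 h2
  refine h.no_square i (max (mu.rowLen i) (lam.rowLen (i + 1) - 2)) ?_
  simp only [mem_skewCells]
  omega

/-- The two boxes of a column of length two. -/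
lemma column (h : IsRibbonWithRows α lam mu) (h2 : ∀ i < α.colLen 0, 2 ≤ α.rowLen i)
    {i i' j : ℕ} (hi : i < i') (hc : (i, j) ∈ skewCells lam mu)
    (hc' : (i', j) ∈ skewCells lam mu) :
    i' = i + 1 ∧ mu.rowLen i = j ∧ lam.rowLen i' = j + 1 := by
  have hlt := h.lt_of_mem hc'
  rw [mem_skewCells] at hc hc'
  have h3 := h.rowLen_succ_le i
  have h4 := antitone_rowLen lam (show i + 1 ≤ i' from hi)
  -- A longer column would contain both the first and the last box of row i + 1, but that row has at
  -- least two boxes.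
  have h5 : i' = i + 1 := by
    by_contra hcon
    have h6 := h.rowLen_succ_le (i + 1)
    have h7 := antitone_rowLen lam (show i + 1 + 1 ≤ i' by omega)
    have h8 := h.add_rowLen (i + 1)
    have h9 := h2 (i + 1) (by omega)
    omega
  subst h5
  omega

/-- The overlapping partition counts the rows that overlap the next row. -/
lemma overlap_eq (h : IsRibbonWithRows α lam mu) (h2 : ∀ i < α.colLen 0, 2 ≤ α.rowLen i)
    (i : ℕ) : overlap lam mu i =
      countFrom (fun q => mu.rowLen q < lam.rowLen (q + 1)) i (α.colLen 0 - 1) := by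
  classical
  have hmem : ∀ q, mu.rowLen q < lam.rowLen (q + 1) →
      (q, mu.rowLen q) ∈ skewCells lam mu ∧ (q + 1, mu.rowLen q) ∈ skewCells lam mu := by
    intro q hq
    have h3 := antitone_rowLen lam (Nat.le_succ q)
    have h4 := antitone_rowLen mu (Nat.le_succ q)
    simp only [Nat.succ_eq_add_one] at h3 h4
    simp only [mem_skewCells]
    omega
  unfold overlap countFrom
  symm
  refine card_bij (fun q _ => mu.rowLen q) ?_ ?_ ?_
  · intro q hq
    simp only [mem_filter, mem_Ico] at hq
    obtain ⟨h3, h4⟩ := hmem q hq.2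
    simp only [mem_filter, mem_range]
    refine ⟨?_, ?_⟩
    · have := antitone_rowLen lam (Nat.zero_le (q + 1))
      omega
    · rw [card_eq_two]
      refine ⟨(q, mu.rowLen q), (q + 1, mu.rowLen q), by simp, ?_⟩
      ext ⟨a, b⟩
      simp only [mem_filter, mem_insert, mem_singleton, Prod.mk.injEq]
      constructor
      · rintro ⟨hc, rfl, hia⟩
        refine (?_ : a = q ∨ a = q + 1).imp (⟨·, rfl⟩) (⟨·, rfl⟩)
        rcases Nat.lt_trichotomy a q with haq | haq | haq
        · have := (h.column h2 (show a < q + 1 by omega) hc h4).1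
          omega
        · exact Or.inl haq
        · exact Or.inr (h.column h2 haq h3 hc).1
      · rintro (⟨rfl, rfl⟩ | ⟨rfl, rfl⟩)
        · exact ⟨h3, rfl, hq.1.1⟩
        · exact ⟨h4, rfl, by omega⟩
  · intro q hq q' hq' heq
    simp only [mem_filter, mem_Ico] at hq hq'
    obtain ⟨h3, h4⟩ := hmem q hq.2
    obtain ⟨h5, h6⟩ := hmem q' hq'.2
    by_contra hne
    rcases Nat.lt_or_gt_of_ne hne with hlt | hlt
    · rw [← heq] at h6
      have := (h.column h2 (show q < q' + 1 by omega) h3 h6).1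
      omega
    · rw [heq] at h4
      have := (h.column h2 (show q' < q + 1 by omega) h5 h4).1
      omega
  · intro j hj
    simp only [mem_filter, mem_range] at hj
    obtain ⟨⟨a, b⟩, ⟨a', b'⟩, hne, hset⟩ := card_eq_two.1 hj.2
    have hc : (a, b) ∈ ({(a, b), (a', b')} : Finset (ℕ × ℕ)) := by simp
    have hc' : (a', b') ∈ ({(a, b), (a', b')} : Finset (ℕ × ℕ)) := by simp
    rw [← hset] at hc hc'
    simp only [mem_filter] at hc hc'
    obtain ⟨hc1, rfl, hc2⟩ := hc
    obtain ⟨hc1', rfl, hc2'⟩ := hc'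
    have hfin : ∀ p p', p < p' → i ≤ p → (p, b') ∈ skewCells lam mu →
        (p', b') ∈ skewCells lam mu →
        ∃ q, ∃ _ : q ∈ {q ∈ Ico i (α.colLen 0 - 1) | mu.rowLen q < lam.rowLen (q + 1)},
          mu.rowLen q = b' := by
      intro p p' hpp hip hp hp'
      obtain ⟨rfl, h3, h4⟩ := h.column h2 hpp hp hp'
      have := h.lt_of_mem hp'
      refine ⟨p, ?_, h3⟩
      simp only [mem_filter, mem_Ico]
      omega
    have hne' : a ≠ a' := fun h => hne (by rw [h])
    rcases Nat.lt_or_gt_of_ne hne' with hlt | hlt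
    · simpa using hfin a a' hlt hc2 hc1 hc1'
    · simpa using hfin a' a hlt hc2' hc1' hc1

end IsRibbonWithRows

/-! ### Littlewood-Richardson tableaux and strip matrices -/

/-- The least `i` with `t < F (i + 1)`. -/
noncomputable def levelIndex (F : ℕ → ℕ) (t : ℕ) : ℕ := sInf {i | t < F (i + 1)}

lemma levelIndex_le_iff {F : ℕ → ℕ} (hF : Monotone F) {t n : ℕ} (h0 : F 0 ≤ t) (hn : t < F n)
    {i : ℕ} : levelIndex F t ≤ i ↔ t < F (i + 1) := by
  constructor
  · intro h
    have hne : {i | t < F (i + 1)}.Nonempty := by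
      refine ⟨n - 1, ?_⟩
      rcases Nat.eq_zero_or_pos n with rfl | hpos
      · omega
      · change t < F (n - 1 + 1)
        rwa [Nat.sub_add_cancel hpos]
    have h1 : t < F (levelIndex F t + 1) := Nat.sInf_mem hne
    exact h1.trans_le (hF (by omega))
  · exact fun h => Nat.sInf_le h

lemma levelIndex_eq_iff {F : ℕ → ℕ} (hF : Monotone F) {t n : ℕ} (h0 : F 0 ≤ t) (hn : t < F n)
    {i : ℕ} : levelIndex F t = i ↔ F i ≤ t ∧ t < F (i + 1) := by
  have h1 := levelIndex_le_iff hF h0 hn (i := i)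
  rcases Nat.eq_zero_or_pos i with rfl | hi
  · simp only [Nat.le_zero] at h1
    rw [h1]
    tauto
  · have h2 := levelIndex_le_iff hF h0 hn (i := i - 1)
    rw [Nat.sub_add_cancel hi] at h2
    omega

lemma monotone_sum_range (f : ℕ → ℕ) : Monotone fun n => ∑ i ∈ range n, f i :=
  fun _ _ h => sum_le_sum_of_subset (range_subset_range.2 h)

namespace SkewSSYT

variable {lam mu : YoungDiagram}

/-- The number of letters `i + 1` in row `j`. -/
def rowCount (T : SkewSSYT lam mu) (j i : ℕ) : ℕ :=
  #{c ∈ skewCells lam mu | c.1 = j ∧ T.entry c.1 c.2 = i + 1}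

lemma sum_rowCount (T : SkewSSYT lam mu) (n i : ℕ) : ∑ j ∈ range n, T.rowCount j i =
    #{c ∈ skewCells lam mu | c.1 < n ∧ T.entry c.1 c.2 = i + 1} := by
  rw [card_eq_sum_card_fiberwise (f := Prod.fst) (t := range n)]
  · refine sum_congr rfl fun j hj => ?_
    have := mem_range.1 hj
    unfold rowCount
    rw [filter_filter]
    congr 1
    refine filter_congr fun c _ => ?_
    constructor
    · rintro ⟨rfl, h⟩
      exact ⟨⟨this, h⟩, rfl⟩
    · rintro ⟨⟨_, h⟩, h'⟩
      exact ⟨h', h⟩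
  · intro c hc
    simp at hc
    simp [hc.2.1]

lemma le_of_hasContent {T : SkewSSYT lam mu} {ν : YoungDiagram} (hT : T.HasContent ν) (i j : ℕ) :
    T.entry i j ≤ ν.colLen 0 := by
  by_contra hcon
  have hmem : (i, j) ∈ skewCells lam mu := by
    by_contra hmem
    rw [T.zeros hmem] at hcon
    omega
  have h1 := hT (T.entry i j - 1)
  rw [rowLen_eq_zero (by omega), card_eq_zero] at h1
  have h2 : (i, j) ∈ ({c ∈ skewCells lam mu | T.entry c.1 c.2 = T.entry i j - 1 + 1}) := by
    simp only [mem_filter]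
    exact ⟨hmem, by omega⟩
  rw [h1] at h2
  simp at h2

lemma ext_entry {T T' : SkewSSYT lam mu}
    (h : ∀ c ∈ skewCells lam mu, T.entry c.1 c.2 = T'.entry c.1 c.2) : T = T' := by
  have : T.entry = T'.entry := by
    funext i j
    by_cases hc : (i, j) ∈ skewCells lam mu
    · exact h _ hc
    · rw [T.zeros hc, T'.zeros hc]
  cases T
  cases T'
  simp only at this
  subst this
  rfl

instance finite_lr (ν : YoungDiagram) :
    Finite {T : SkewSSYT lam mu // T.HasContent ν ∧ T.IsYamanouchi} := by
  refine Finite.of_injective (β := skewCells lam mu → Fin (ν.colLen 0 + 1))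
    (fun T c => ⟨T.1.entry c.1.1 c.1.2, Nat.lt_succ_of_le (le_of_hasContent T.2.1 _ _)⟩) ?_
  intro T T' h
  refine Subtype.ext (ext_entry fun c hc => ?_)
  have := congrFun h ⟨c, hc⟩
  simpa using this

end SkewSSYT

lemma lrCoeff_pos_iff {lam mu ν : YoungDiagram} :
    0 < lrCoeff lam mu ν ↔ ∃ T : SkewSSYT lam mu, T.HasContent ν ∧ T.IsYamanouchi := by
  unfold lrCoeff
  rw [Nat.card_pos_iff, nonempty_subtype]
  exact and_iff_left inferInstance

lemma StripMatrix.sum_range_le {α ν : ℕ → ℕ} {D : ℕ → Prop} {k N : ℕ} {X : ℕ → ℕ → ℕ}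
    (h : StripMatrix α ν D k N X) (hzero : ∀ i, N ≤ i → ν i = 0) {j : ℕ} (hj : j < k) (n : ℕ) :
    ∑ q ∈ range n, X j q ≤ α j := by
  rw [← (h.enlarge (le_max_left N n) hzero).row_sum j hj]
  exact sum_le_sum_of_subset (range_subset_range.2 (le_max_right N n))

variable {α lam mu ν : YoungDiagram}

/-- The numbers of letters in the rows of a Littlewood-Richardson tableau. -/
lemma IsRibbonWithRows.stripMatrix_rowCount (h : IsRibbonWithRows α lam mu) {N : ℕ}
    (hN : ν.colLen 0 ≤ N) {T : SkewSSYT lam mu} (hT : T.HasContent ν) (hY : T.IsYamanouchi) :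
    StripMatrix α.rowLen ν.rowLen (fun q => mu.rowLen q < lam.rowLen (q + 1)) (α.colLen 0) N
      T.rowCount := by
  have hpos : ∀ i j, (i, j) ∈ skewCells lam mu → 0 < T.rowCount i (T.entry i j - 1) := by
    intro i j hc
    refine card_pos.2 ⟨(i, j), ?_⟩
    simp only [mem_filter, true_and]
    have := T.pos hc
    exact ⟨hc, by omega⟩
  refine ⟨fun j _ => ?_, fun i => ?_, fun j _ i => ?_, fun j hj hD => ?_⟩
  · have h1 : #{c ∈ skewCells lam mu | c.1 = j} = α.rowLen j := by
      have : {c ∈ skewCells lam mu | c.1 = j} =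
          (Ico (mu.rowLen j) (lam.rowLen j)).image fun b => (j, b) := by
        ext ⟨a, b⟩
        simp only [mem_filter, mem_skewCells, mem_image, mem_Ico, Prod.mk.injEq]
        constructor
        · rintro ⟨hab, rfl⟩
          exact ⟨b, hab, rfl, rfl⟩
        · rintro ⟨b', hb, rfl, rfl⟩
          exact ⟨hb, rfl⟩
      rw [this, card_image_of_injective _ (Prod.mk_right_injective j), Nat.card_Ico, h.rows]
    rw [← h1, card_eq_sum_card_fiberwise (f := fun c => T.entry c.1 c.2 - 1) (t := range N)]
    · refine sum_congr rfl fun i _ => ?_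
      unfold SkewSSYT.rowCount
      rw [filter_filter]
      congr 1
      refine filter_congr fun c hc => ?_
      have := T.pos (i := c.1) (j := c.2) hc
      omega
    · rintro ⟨a, b⟩ hc
      simp at hc
      have h2 := T.pos hc.1
      have h3 := SkewSSYT.le_of_hasContent hT a b
      simp
      omega
  · rw [T.sum_rowCount, ← hT i]
    congr 1
    refine filter_congr fun c hc => ?_
    exact and_iff_right (h.lt_of_mem (j := c.2) hc)
  · rw [T.sum_rowCount, T.sum_rowCount]
    -- The Yamanouchi condition is used at the point of row j where all entries at least i + 2 have
    -- been read: every i + 2 of the row is counted and no i + 1.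
    have hex : ∃ b, ∀ b', b ≤ b' → (j, b') ∈ skewCells lam mu → i + 2 ≤ T.entry j b' := by
      refine ⟨lam.rowLen j, fun b' hb hc => ?_⟩
      rw [mem_skewCells] at hc
      omega
    classical
    have hspec := Nat.find_spec hex
    have hmin := fun m => Nat.find_min' hex (m := m)
    refine le_trans (card_le_card ?_) ((hY j (Nat.find hex) (i + 1) (by omega)).trans
      (card_le_card ?_))
    · intro c hc
      simp only [mem_filter] at hc ⊢
      obtain ⟨hc1, hc2, hc3⟩ := hc
      refine ⟨hc1, ?_, hc3⟩
      rcases Nat.lt_succ_iff_lt_or_eq.1 hc2 with hlt | heq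
      · exact Or.inl hlt
      · refine Or.inr ⟨heq, hmin _ fun b' hb hb' => ?_⟩
        subst heq
        rcases hb.lt_or_eq with hlt | heq'
        · have := T.row_weak hlt hc1 hb'
          omega
        · rw [← heq']
          omega
    · intro c hc
      simp only [mem_filter] at hc ⊢
      obtain ⟨hc1, hc2, hc3⟩ := hc
      refine ⟨hc1, ?_, hc3⟩
      rcases hc2 with hlt | ⟨heq, hb⟩
      · exact hlt
      · have := hspec c.2 hb (by rw [← heq]; exact hc1)
        rw [← heq] at this
        omega
  · have h3 := antitone_rowLen lam (Nat.le_succ j)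
    have h4 := antitone_rowLen mu (Nat.le_succ j)
    simp only [Nat.succ_eq_add_one] at h3 h4
    have hc : (j, mu.rowLen j) ∈ skewCells lam mu := mem_skewCells.2 (by omega)
    have hc' : (j + 1, mu.rowLen j) ∈ skewCells lam mu := mem_skewCells.2 (by omega)
    have := T.col_strict (show j < j + 1 by omega) hc hc'
    have := T.pos hc
    exact ⟨_, _, by omega, hpos _ _ hc, hpos _ _ hc'⟩

/-- The Littlewood-Richardson tableau with given numbers of letters in its rows. -/
lemma IsRibbonWithRows.exists_tableau (h : IsRibbonWithRows α lam mu)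
    (h2 : ∀ i < α.colLen 0, 2 ≤ α.rowLen i) {N : ℕ} (hN : ν.colLen 0 ≤ N) {X : ℕ → ℕ → ℕ}
    (hX : StripMatrix α.rowLen ν.rowLen (fun q => mu.rowLen q < lam.rowLen (q + 1)) (α.colLen 0) N
      X) : ∃ T : SkewSSYT lam mu, T.HasContent ν ∧ T.IsYamanouchi := by
  classical
  have hzero : ∀ i, N ≤ i → ν.rowLen i = 0 := fun i hi => rowLen_eq_zero (hN.trans hi)
  have hrange : ∀ i j, (i, j) ∈ skewCells lam mu →
      j - mu.rowLen i < ∑ q ∈ range N, X i q := by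
    intro i j hc
    rw [hX.row_sum i (h.lt_of_mem hc)]
    have := h.add_rowLen i
    rw [mem_skewCells] at hc
    omega
  have hle : ∀ {i j}, (i, j) ∈ skewCells lam mu → ∀ {m},
      (levelIndex (fun n => ∑ q ∈ range n, X i q) (j - mu.rowLen i) ≤ m ↔
        j - mu.rowLen i < ∑ q ∈ range (m + 1), X i q) := fun hc m =>
    levelIndex_le_iff (monotone_sum_range _) (by simp) (hrange _ _ hc)
  have heq : ∀ {i j}, (i, j) ∈ skewCells lam mu → ∀ {m},
      (levelIndex (fun n => ∑ q ∈ range n, X i q) (j - mu.rowLen i) = m ↔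
        ∑ q ∈ range m, X i q ≤ j - mu.rowLen i ∧
        j - mu.rowLen i < ∑ q ∈ range (m + 1), X i q) := fun hc m =>
    levelIndex_eq_iff (monotone_sum_range _) (by simp) (hrange _ _ hc)
  let T : SkewSSYT lam mu :=
    { entry := fun i j => if (i, j) ∈ skewCells lam mu then
        levelIndex (fun n => ∑ q ∈ range n, X i q) (j - mu.rowLen i) + 1 else 0
      pos := fun hc => by simp [hc]
      row_weak := fun {i j₁ j₂} hj hc₁ hc₂ => by
        rw [if_pos hc₁, if_pos hc₂, Nat.add_le_add_iff_right, hle hc₁]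
        exact lt_of_le_of_lt (by omega) ((hle hc₂).1 le_rfl)
      col_strict := fun {i₁ i₂ j} hi hc₁ hc₂ => by
        rw [if_pos hc₁, if_pos hc₂, Nat.add_lt_add_iff_right]
        have hlt := h.lt_of_mem hc₂
        obtain ⟨rfl, h3, h4⟩ := h.column h2 hi hc₁ hc₂
        obtain ⟨a, b, hab, ha, hb⟩ := hX.ascent i₁ hlt (by omega)
        -- The upper box is the first of its row, so its letter is at most a; the lower one is the
        -- last of its row, so its letter is at least b.
        refine lt_of_le_of_lt ((hle hc₁ (m := a)).2 ?_) (hab.trans_le ?_)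
        · rw [sum_range_succ]
          omega
        · by_contra hcon
          push Not at hcon
          have h5 := (hle hc₂ (m := b - 1)).1 (by omega)
          rw [show b - 1 + 1 = b by omega] at h5
          have h6 := hX.sum_range_le hzero hlt (b + 1)
          have h7 := h.add_rowLen (i₁ + 1)
          rw [sum_range_succ] at h6
          have h8 := mem_skewCells.1 hc₂
          omega
      zeros := fun hc => if_neg hc }
  have hentry : ∀ {i j}, (i, j) ∈ skewCells lam mu → T.entry i j =
      levelIndex (fun n => ∑ q ∈ range n, X i q) (j - mu.rowLen i) + 1 := fun hc => if_pos hc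
  have hcount : ∀ j < α.colLen 0, ∀ m, T.rowCount j m = X j m := by
    intro j hj m
    have : {c ∈ skewCells lam mu | c.1 = j ∧ T.entry c.1 c.2 = m + 1} =
        (Ico (∑ q ∈ range m, X j q) (∑ q ∈ range (m + 1), X j q)).image
          fun t => (j, mu.rowLen j + t) := by
      ext ⟨a, b⟩
      simp only [mem_filter, mem_image, mem_Ico, Prod.mk.injEq]
      constructor
      · rintro ⟨hc, rfl, hT⟩
        rw [hentry hc, Nat.add_right_cancel_iff, heq hc] at hT
        have := mem_skewCells.1 hc
        exact ⟨b - mu.rowLen a, hT, rfl, by omega⟩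
      · rintro ⟨t, ht, rfl, rfl⟩
        have h3 := hX.sum_range_le hzero hj (m + 1)
        have h4 := h.add_rowLen j
        have hc : (j, mu.rowLen j + t) ∈ skewCells lam mu := mem_skewCells.2 (by omega)
        refine ⟨hc, rfl, ?_⟩
        rw [hentry hc, Nat.add_right_cancel_iff, heq hc, Nat.add_sub_cancel_left]
        exact ht
    unfold SkewSSYT.rowCount
    rw [this, card_image_of_injective _ fun t t' htt => by simpa using htt, Nat.card_Ico,
      sum_range_succ, Nat.add_sub_cancel_left]
  have hsum : ∀ n ≤ α.colLen 0, ∀ m, ∑ j ∈ range n, X j m =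
      #{c ∈ skewCells lam mu | c.1 < n ∧ T.entry c.1 c.2 = m + 1} := by
    intro n hn m
    rw [← T.sum_rowCount]
    exact sum_congr rfl fun j hj => (hcount j ((mem_range.1 hj).trans_le hn) m).symm
  have hcontent : T.HasContent ν := by
    intro m
    rw [← hX.col_sum, hsum _ le_rfl]
    congr 1
    refine filter_congr fun c hc => ?_
    exact (and_iff_right (h.lt_of_mem (j := c.2) hc)).symm
  refine ⟨T, hcontent, fun a b m hm => ?_⟩
  obtain ⟨i, rfl⟩ : ∃ i, m = i + 1 := ⟨m - 1, by omega⟩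
  by_cases ha : a < α.colLen 0
  -- The strip condition compares all of row a with the rows before it, so the position inside row a
  -- is irrelevant.
  · have h3 := hX.strip a ha i
    rw [hsum _ ha, hsum _ ha.le] at h3
    refine le_trans (card_le_card ?_) (h3.trans (card_le_card ?_))
    · intro c hc
      simp only [mem_filter] at hc ⊢
      exact ⟨hc.1, by omega, hc.2.2⟩
    · intro c hc
      simp only [mem_filter] at hc ⊢
      exact ⟨hc.1, Or.inl hc.2.1, hc.2.2⟩
  · have h3 : ∀ m, T.prefixCount a b (m + 1) = ν.rowLen m := by
      intro m
      rw [← hcontent m]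
      unfold SkewSSYT.prefixCount
      congr 1
      refine filter_congr fun c hc => ?_
      have := h.lt_of_mem (j := c.2) hc
      exact and_iff_right (Or.inl (by omega))
    rw [h3, h3]
    exact antitone_rowLen ν (Nat.le_succ i)

/-! ### Standard tableaux and strip matrices -/

/-- Ranking the elements of a finite set along an injective key is a bijection. -/
lemma bijOn_rank {ι κ : Type*} [LinearOrder κ] (s : Finset ι) {f : ι → κ}
    (hf : Set.InjOn f s) :
    Set.BijOn (fun c => #{c' ∈ s | f c' ≤ f c}) (s : Set ι) (Set.Icc 1 #s) := by
  have hmaps : Set.MapsTo (fun c => #{c' ∈ s | f c' ≤ f c}) (s : Set ι) (Finset.Icc 1 #s) := by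
    intro c hc
    rw [Finset.mem_coe, mem_Icc]
    exact ⟨card_pos.2 ⟨c, by simpa using hc⟩, card_le_card (filter_subset _ _)⟩
  have hinj : Set.InjOn (fun c => #{c' ∈ s | f c' ≤ f c}) (s : Set ι) := by
    intro c hc c' hc' heq
    apply hf hc hc'
    by_contra hne
    have hlt : ∀ a ∈ s, ∀ b ∈ s, f a < f b →
        #{c' ∈ s | f c' ≤ f a} < #{c' ∈ s | f c' ≤ f b} := by
      intro a _ b hb hab
      apply card_lt_card
      rw [ssubset_iff_of_subset (monotone_filter_right _ fun d _ hd => hd.trans hab.le)]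
      exact ⟨b, by simp [hb], by simp [hab]⟩
    rcases lt_or_gt_of_ne hne with h | h
    · exact (hlt c hc c' hc' h).ne heq
    · exact (hlt c' hc' c hc h).ne' heq
  rw [← coe_Icc]
  exact ⟨hmaps, hinj, surjOn_of_injOn_of_card_le _ hmaps hinj (by simp)⟩

lemma rank_lt_rank_iff {ι κ : Type*} [LinearOrder κ] {s : Finset ι} {f : ι → κ} {a b : ι}
    (hb : b ∈ s) :
    #{c ∈ s | f c ≤ f a} < #{c ∈ s | f c ≤ f b} ↔ f a < f b := by
  constructor
  · intro h
    by_contra hcon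
    push Not at hcon
    exact h.not_ge (card_le_card (monotone_filter_right _ fun d _ hd => hd.trans hcon))
  · intro hab
    apply card_lt_card
    rw [ssubset_iff_of_subset (monotone_filter_right _ fun d _ hd => hd.trans hab.le)]
    exact ⟨b, by simp [hb], by simp [hab]⟩

/-- The numbers of entries in the rows and segments of a standard tableau with descent set
`partialSums α`. -/
lemma stripMatrix_of_descentSet (hα : ∀ i < α.colLen 0, 0 < α.rowLen i) (hν : ν.card = α.card)
    {N : ℕ} (hN : ν.colLen 0 ≤ N) {U : SemistandardYoungTableau ν} (hU : IsStandard U)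
    (hdes : descentSet U = partialSums α) :
    StripMatrix α.rowLen ν.rowLen (fun _ => True) (α.colLen 0) N fun j i =>
      #{c ∈ ν.cells | c.1 = i ∧ ∑ q ∈ range j, α.rowLen q < U c.1 c.2 ∧
        U c.1 c.2 ≤ ∑ q ∈ range (j + 1), α.rowLen q} := by
  have hmono := monotone_sum_range α.rowLen
  have htot : ∑ q ∈ range (α.colLen 0), α.rowLen q = ν.card := by
    rw [hν, card_eq_sum_rowLen α le_rfl]
  have hbd : ∀ c ∈ ν.cells, 1 ≤ U c.1 c.2 ∧ U c.1 c.2 ≤ ν.card := fun c hc => hU.mapsTo hc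
  have hex : ∀ t, 1 ≤ t → t ≤ ν.card → ∃ c ∈ ν.cells, U c.1 c.2 = t := fun t h1 h2 =>
    hU.surjOn ⟨h1, h2⟩
  have hcol : ∀ n i, ∑ j ∈ range n, #{c ∈ ν.cells | c.1 = i ∧
      ∑ q ∈ range j, α.rowLen q < U c.1 c.2 ∧ U c.1 c.2 ≤ ∑ q ∈ range (j + 1), α.rowLen q} =
      #{c ∈ ν.cells | c.1 = i ∧ U c.1 c.2 ≤ ∑ q ∈ range n, α.rowLen q} := by
    intro n i
    induction n with
    | zero =>
      symm
      rw [range_zero, sum_empty, sum_empty, card_eq_zero, filter_eq_empty_iff]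
      intro c hc
      have := hbd c hc
      omega
    | succ n ih =>
      rw [sum_range_succ, ih, ← card_union_of_disjoint]
      · congr 1
        ext c
        have : ∑ q ∈ range n, α.rowLen q ≤ ∑ q ∈ range (n + 1), α.rowLen q :=
          hmono (Nat.le_succ n)
        simp only [mem_union, mem_filter]
        constructor
        · rintro (h | h)
          · exact ⟨h.1, h.2.1, h.2.2.trans this⟩
          · exact ⟨h.1, h.2.1, h.2.2.2⟩
        · rintro ⟨h1, h2, h3⟩
          rcases Nat.lt_or_ge (∑ q ∈ range n, α.rowLen q) (U c.1 c.2) with h | h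
          · exact Or.inr ⟨h1, h2, h, h3⟩
          · exact Or.inl ⟨h1, h2, h⟩
      · rw [disjoint_left]
        intro c hc hc'
        simp only [mem_filter] at hc hc'
        omega
  -- Inside a segment there is no descent, so larger entries lie in weakly higher rows.
  have hweak : ∀ j s t, s ≤ t → ∑ q ∈ range j, α.rowLen q < s →
      t ≤ ∑ q ∈ range (j + 1), α.rowLen q → ∀ c ∈ ν.cells, U c.1 c.2 = s →
      ∀ c' ∈ ν.cells, U c'.1 c'.2 = t → c'.1 ≤ c.1 := by
    intro j s t hst hs
    induction t, hst using Nat.le_induction with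
    | base =>
      intro _ c hc h c' hc' h'
      have : c = c' := hU.injOn hc hc' (h.trans h'.symm)
      rw [this]
    | succ t hst ih =>
      intro ht c hc h c' hc' h'
      have h1 := hbd c' hc'
      obtain ⟨d, hd, hdt⟩ := hex t (by omega) (by omega)
      refine le_trans ?_ (ih (by omega) c hc h d hd hdt)
      by_contra hcon
      push Not at hcon
      have hmem : t ∈ descentSet U := ⟨d.1, d.2, c'.1, c'.2, hd, hc', hdt, h', hcon⟩
      rw [hdes] at hmem
      obtain ⟨m, -, -, hm⟩ := hmem
      rcases Nat.lt_or_ge j m with hjm | hjm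
      · have : ∑ q ∈ range (j + 1), α.rowLen q ≤ ∑ q ∈ range m, α.rowLen q := hmono hjm
        omega
      · have : ∑ q ∈ range m, α.rowLen q ≤ ∑ q ∈ range j, α.rowLen q := hmono hjm
        omega
  refine ⟨fun j hj => ?_, fun i => ?_, fun j _ i => ?_, fun j hj _ => ?_⟩
  · have h1 : #{c ∈ ν.cells | ∑ q ∈ range j, α.rowLen q < U c.1 c.2 ∧
        U c.1 c.2 ≤ ∑ q ∈ range (j + 1), α.rowLen q} = α.rowLen j := by
      have h2 : ({c ∈ ν.cells | ∑ q ∈ range j, α.rowLen q < U c.1 c.2 ∧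
          U c.1 c.2 ≤ ∑ q ∈ range (j + 1), α.rowLen q}).image (fun c => U c.1 c.2) =
          Ioc (∑ q ∈ range j, α.rowLen q) (∑ q ∈ range (j + 1), α.rowLen q) := by
        ext t
        simp only [mem_image, mem_filter, mem_Ioc]
        constructor
        · rintro ⟨c, ⟨-, h⟩, rfl⟩
          exact h
        · intro h
          have : ∑ q ∈ range (j + 1), α.rowLen q ≤ ∑ q ∈ range (α.colLen 0), α.rowLen q :=
            hmono hj
          obtain ⟨c, hc, rfl⟩ := hex t (by omega) (by omega)
          exact ⟨c, ⟨hc, h⟩, rfl⟩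
      rw [← card_image_of_injOn (f := fun c : ℕ × ℕ => U c.1 c.2), h2, Nat.card_Ioc,
        sum_range_succ, Nat.add_sub_cancel_left]
      exact hU.injOn.mono fun c hc => (mem_filter.1 hc).1
    rw [← h1, card_eq_sum_card_fiberwise (f := Prod.fst) (t := range N)]
    · refine sum_congr rfl fun i _ => ?_
      rw [filter_filter]
      congr 1
      refine filter_congr fun c _ => ?_
      tauto
    · rintro ⟨a, b⟩ hc
      have hc : (a, b) ∈ ν := (mem_filter.1 hc).1
      have := YoungDiagram.mem_iff_lt_rowLen.1 hc
      have := (lt_colLen_zero_iff (α := ν) (i := a)).2 (by omega)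
      simp
      omega
  · rw [hcol, htot, YoungDiagram.rowLen_eq_card]
    unfold YoungDiagram.row
    congr 1
    refine filter_congr fun c hc => ?_
    exact and_iff_left (hbd c hc).2
  · rw [hcol, hcol]
    -- Each box goes to the box above it. The entry there is smaller, and it is not in segment j,
    -- since `hweak` would then put the lower box weakly above the upper one.
    refine card_le_card_of_injOn (fun c => (i, c.2)) ?_ ?_
    · rintro ⟨a, b⟩ hc
      obtain ⟨hc, rfl, hle⟩ := mem_filter.1 hc
      have hc : (i + 1, b) ∈ ν := hc
      have hc' : (i, b) ∈ ν := ν.up_left_mem (Nat.le_succ i) le_rfl hc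
      refine mem_filter.2 ⟨hc', rfl, ?_⟩
      by_contra hcon
      push Not at hcon
      have hlt : U i b < U (i + 1) b := U.col_strict (Nat.lt_succ_self i) hc
      have := hweak j _ _ hlt.le hcon hle (i, b) hc' rfl (i + 1, b) hc rfl
      simp at this
    · rintro ⟨a, b⟩ hc ⟨a', b'⟩ hc' heq
      obtain ⟨-, rfl, -⟩ := mem_filter.1 hc
      obtain ⟨-, h, -⟩ := mem_filter.1 hc'
      simp at heq h
      simp [heq, h]
  · have hmem : ∑ q ∈ range (j + 1), α.rowLen q ∈ descentSet U := by
      rw [hdes]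
      exact ⟨j + 1, by omega, hj, rfl⟩
    obtain ⟨a, b, a', b', hc, hc', h1, h2, h3⟩ := hmem
    have h4 := hα j (by omega)
    have h5 := hα (j + 1) hj
    refine ⟨a, a', h3, card_pos.2 ⟨(a, b), ?_⟩, card_pos.2 ⟨(a', b'), ?_⟩⟩
    · refine mem_filter.2 ⟨hc, rfl, ?_⟩
      simp only [h1]
      rw [sum_range_succ]
      omega
    · refine mem_filter.2 ⟨hc', rfl, ?_⟩
      simp only [h2]
      rw [sum_range_succ _ (j + 1)]
      omega

lemma StripMatrix.sum_succ_le_of_lt {α ν : ℕ → ℕ} {D : ℕ → Prop} {k N : ℕ} {X : ℕ → ℕ → ℕ}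
    (h : StripMatrix α ν D k N X) {n : ℕ} (hn : n < k) {i i' : ℕ} (hi : i < i') :
    ∑ q ∈ range (n + 1), X q i' ≤ ∑ q ∈ range n, X q i := by
  induction i', (Nat.succ_le_of_lt hi) using Nat.le_induction with
  | base => exact h.strip n hn i
  | succ m hm ih =>
    exact ((h.strip n hn m).trans (sum_le_sum_of_subset
      (range_subset_range.2 (Nat.le_succ n)))).trans (ih (by omega))

/-- The standard tableau with given numbers of entries in its rows and segments: the boxes are
ordered by segment, then from the bottom row to the top row, then from left to right. -/
lemma StripMatrix.exists_standard {N : ℕ} (hN : ν.colLen 0 ≤ N) {X : ℕ → ℕ → ℕ}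
    (hX : StripMatrix α.rowLen ν.rowLen (fun _ => True) (α.colLen 0) N X) :
    ∃ U : SemistandardYoungTableau ν, IsStandard U ∧ descentSet U = partialSums α := by
  classical
  have hCmono : ∀ i, Monotone fun n => ∑ q ∈ range n, X q i := fun i =>
    monotone_sum_range fun q => X q i
  have hPmono := monotone_sum_range α.rowLen
  -- Row i is cut from left to right into blocks of lengths X 0 i, X 1 i, …; `seg` is the index of
  -- the block.
  obtain ⟨seg, hseg⟩ : ∃ seg : ℕ × ℕ → ℕ, ∀ c ∈ ν.cells, ∀ n,
      (seg c ≤ n ↔ c.2 < ∑ q ∈ range (n + 1), X q c.1) := by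
    refine ⟨fun c => levelIndex (fun n => ∑ q ∈ range n, X q c.1) c.2, fun c hc n => ?_⟩
    refine levelIndex_le_iff (n := α.colLen 0) (hCmono c.1) (by simp) ?_
    rw [hX.col_sum]
    exact YoungDiagram.mem_iff_lt_rowLen.1 hc
  have hseglt : ∀ c ∈ ν.cells, seg c < α.colLen 0 := by
    intro c hc
    have h1 := YoungDiagram.mem_iff_lt_rowLen.1 (show (c.1, c.2) ∈ ν from hc)
    rw [← hX.col_sum] at h1
    have h2 : α.colLen 0 ≠ 0 := by
      intro h0
      simp [h0] at h1
    have := (hseg c hc (α.colLen 0 - 1)).2 (by rwa [Nat.sub_add_cancel (by omega)])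
    omega
  have hrowlt : ∀ c ∈ ν.cells, c.1 < N := by
    intro c hc
    have h1 := YoungDiagram.mem_iff_lt_rowLen.1 (show (c.1, c.2) ∈ ν from hc)
    have := (lt_colLen_zero_iff (α := ν) (i := c.1)).2 (by omega)
    omega
  -- N exceeds every row index, so N - c.1 reverses the order of the rows injectively.
  obtain ⟨key, hkey⟩ : ∃ key : ℕ × ℕ → ℕ ×ₗ (ℕ ×ₗ ℕ), ∀ c, key c =
      toLex (seg c, toLex (N - c.1, c.2)) := ⟨_, fun _ => rfl⟩
  have hlt : ∀ c c', key c < key c' ↔ seg c < seg c' ∨ seg c = seg c' ∧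
      (N - c.1 < N - c'.1 ∨ N - c.1 = N - c'.1 ∧ c.2 < c'.2) := by
    intro c c'
    simp only [hkey, Prod.Lex.toLex_lt_toLex]
  have hle : ∀ c c', key c ≤ key c' ↔ seg c < seg c' ∨ seg c = seg c' ∧
      (N - c.1 < N - c'.1 ∨ N - c.1 = N - c'.1 ∧ c.2 ≤ c'.2) := by
    intro c c'
    simp only [hkey, Prod.Lex.toLex_le_toLex]
  have hinj : Set.InjOn key ν.cells := by
    intro c hc c' hc' heq
    have h1 := (hle c c').1 heq.le
    have h2 := (hle c' c).1 heq.ge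
    have h3 := hrowlt c hc
    have h4 := hrowlt c' hc'
    exact Prod.ext (by omega) (by omega)
  have hbij := bijOn_rank ν.cells hinj
  obtain ⟨rank, hrank⟩ : ∃ rank : ℕ × ℕ → ℕ, rank = fun c => #{c' ∈ ν.cells | key c' ≤ key c} :=
    ⟨_, rfl⟩
  rw [← hrank] at hbij
  have hrank_lt : ∀ c, ∀ c' ∈ ν.cells, (rank c < rank c' ↔ key c < key c') := by
    intro c c' hc'
    rw [hrank]
    exact rank_lt_rank_iff hc'
  have hrank_le : ∀ c ∈ ν.cells, ∀ c', (rank c ≤ rank c' ↔ key c ≤ key c') := by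
    intro c hc c'
    rw [← not_lt, hrank_lt c' c hc, not_lt]
  let U : SemistandardYoungTableau ν :=
    { entry := fun i j => if (i, j) ∈ ν then rank (i, j) else 0
      row_weak' := fun {i j₁ j₂} hj hc => by
        have hc₁ : (i, j₁) ∈ ν := ν.up_left_mem le_rfl hj.le hc
        rw [if_pos hc, if_pos hc₁, hrank_le _ hc₁, hle]
        have h1 : seg (i, j₁) ≤ seg (i, j₂) :=
          (hseg _ hc₁ _).2 (hj.trans ((hseg _ hc _).1 le_rfl))
        exact h1.lt_or_eq.imp_right fun h => ⟨h, Or.inr ⟨rfl, hj.le⟩⟩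
      col_strict' := fun {i₁ i₂ j} hi hc => by
        have hc₁ : (i₁, j) ∈ ν := ν.up_left_mem hi.le le_rfl hc
        rw [if_pos hc, if_pos hc₁, hrank_lt _ _ hc, hlt]
        -- By the strip condition, a box above another one belongs to a strictly earlier segment.
        left
        have h1 := ((hseg _ hc _).1 le_rfl).trans_le
          (hX.sum_succ_le_of_lt (hseglt _ hc) hi)
        simp only at h1
        have h2 : seg (i₂, j) ≠ 0 := by
          intro h0
          simp [h0] at h1
        have := (hseg _ hc₁ (seg (i₂, j) - 1)).2 (by rwa [Nat.sub_add_cancel (by omega)])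
        omega
      zeros' := fun hc => if_neg hc }
  have hU : ∀ c ∈ ν.cells, U c.1 c.2 = rank c := fun c hc => if_pos hc
  have hstd : IsStandard U := hbij.congr fun c hc => (hU c hc).symm
  have hcount : ∀ j < α.colLen 0, #{c ∈ ν.cells | seg c ≤ j} =
      ∑ q ∈ range (j + 1), α.rowLen q := by
    intro j hj
    have h1 : ∑ q ∈ range (j + 1), α.rowLen q =
        ∑ i ∈ range N, ∑ q ∈ range (j + 1), X q i := by
      rw [sum_comm]
      exact sum_congr rfl fun q hq => (hX.row_sum q (by have := mem_range.1 hq; omega)).symm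
    rw [h1, card_eq_sum_card_fiberwise (f := Prod.fst) (t := range N)]
    · refine sum_congr rfl fun i _ => ?_
      have : {c ∈ {c ∈ ν.cells | seg c ≤ j} | c.1 = i} =
          (range (∑ q ∈ range (j + 1), X q i)).image fun b => (i, b) := by
        ext ⟨a, b⟩
        simp only [mem_filter, mem_image, mem_range, Prod.mk.injEq]
        constructor
        · rintro ⟨⟨hc, hs⟩, rfl⟩
          exact ⟨b, (hseg _ hc _).1 hs, rfl, rfl⟩
        · rintro ⟨b', hb, rfl, rfl⟩
          have hc : (i, b') ∈ ν.cells := by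
            refine YoungDiagram.mem_iff_lt_rowLen.2 ?_
            rw [← hX.col_sum]
            exact hb.trans_le (hCmono i hj)
          exact ⟨⟨hc, (hseg _ hc _).2 hb⟩, rfl⟩
      rw [this, card_image_of_injective _ (Prod.mk_right_injective i), card_range]
    · intro c hc
      have hc := (mem_filter.1 hc).1
      simpa using hrowlt c hc
  have hrankseg : ∀ c ∈ ν.cells, ∀ j < α.colLen 0,
      (rank c ≤ ∑ q ∈ range (j + 1), α.rowLen q ↔ seg c ≤ j) := by
    intro c hc j hj
    rw [← hcount j hj, hrank]
    constructor
    · intro h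
      by_contra hcon
      push Not at hcon
      refine absurd h (not_le.2 (card_lt_card ?_))
      rw [ssubset_iff_of_subset (monotone_filter_right _ fun d _ hd => (hle _ _).2 (by omega))]
      exact ⟨c, by simpa using hc, by simp [hcon]⟩
    · intro h
      refine card_le_card (monotone_filter_right _ fun d _ hd => ?_)
      have := (hle _ _).1 hd
      omega
  have hcorner : ∀ j < α.colLen 0, ∀ i, 0 < X j i →
      ∃ c ∈ ν.cells, c.1 = i ∧ seg c = j := by
    intro j hj i hpos
    have hc : (i, ∑ q ∈ range j, X q i) ∈ ν.cells := by
      refine YoungDiagram.mem_iff_lt_rowLen.2 ?_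
      rw [← hX.col_sum]
      refine lt_of_lt_of_le ?_ (hCmono i hj)
      simp only [sum_range_succ]
      omega
    refine ⟨_, hc, rfl, le_antisymm ((hseg _ hc j).2 ?_) ?_⟩
    · rw [sum_range_succ]
      simp only
      omega
    · by_contra hcon
      push Not at hcon
      have h1 := (hseg _ hc (j - 1)).1 (by omega)
      rw [Nat.sub_add_cancel (by omega)] at h1
      exact lt_irrefl _ h1
  refine ⟨U, hstd, Set.Subset.antisymm ?_ ?_⟩
  -- Within a segment lower boxes come first, so a descent must pass to a later segment and is
  -- therefore a partial sum.
  · rintro t ⟨i, j, i', j', hc, hc', h1, h2, hi⟩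
    rw [hU (i, j) hc] at h1
    rw [hU (i', j') hc'] at h2
    have h3 := (hlt _ _).1 ((hrank_lt (i, j) _ hc').1 (by omega))
    have h4 := hrowlt _ hc
    have h5 := hseglt _ hc
    have h6 := hseglt _ hc'
    simp only at h3 h4
    have h7 := (hrankseg _ hc _ h5).2 le_rfl
    have h8 := (hrankseg _ hc' _ h5).not.2 (by omega)
    exact ⟨seg (i, j) + 1, by omega, by omega, by omega⟩
  · rintro t ⟨m, hm, hmk, rfl⟩
    obtain ⟨j, rfl⟩ : ∃ j, m = j + 1 := ⟨m - 1, by omega⟩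
    obtain ⟨a, b, hab, ha, hb⟩ := hX.ascent j hmk trivial
    obtain ⟨ca, hca, rfl, hsa⟩ := hcorner j (by omega) a ha
    obtain ⟨cb, hcb, rfl, hsb⟩ := hcorner (j + 1) hmk b hb
    have hra := (hrankseg ca hca j (by omega)).2 hsa.le
    have hrb := (hrankseg cb hcb j (by omega)).not.2 (by omega)
    have h1 := hbij.mapsTo hca
    have h2 := hbij.mapsTo hcb
    rw [Set.mem_Icc] at h1 h2
    -- c is the last box of segment j, hence weakly above ca; c' is the first box of segment j + 1,
    -- hence weakly below cb.
    obtain ⟨c, hc, hrc⟩ := hbij.surjOn (⟨by omega, by omega⟩ :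
      ∑ q ∈ range (j + 1), α.rowLen q ∈ Set.Icc 1 #ν.cells)
    obtain ⟨c', hc', hrc'⟩ := hbij.surjOn (⟨by omega, by omega⟩ :
      ∑ q ∈ range (j + 1), α.rowLen q + 1 ∈ Set.Icc 1 #ν.cells)
    refine ⟨c.1, c.2, c'.1, c'.2, hc, hc', by rw [hU c hc, hrc], by rw [hU c' hc', hrc'], ?_⟩
    have h3 := (hrankseg c hc j (by omega)).1 hrc.le
    have h4 := (hrankseg c' hc' j (by omega)).not.1 (by omega)
    have h5 := (hle _ _).1 ((hrank_le ca hca c).1 (by omega))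
    have h6 := (hle _ _).1 ((hrank_le c' hc' cb).1 (by omega))
    have h7 := hrowlt _ hca
    have h8 := hrowlt _ hcb
    have h9 := hrowlt _ hc
    have h10 := hrowlt _ hc'
    omega

/-! ### The inequalities of the theorem and its proof -/

/-- The upper end of the dominance interval adds nothing: as the size is fixed, it amounts to the
inequality for the first row. Where p i = 0, the inequality follows from dominance, so the
restriction to positive entries is harmless. -/
lemma satisfiesInequalities_iff (hν : ν.card = α.card) (D : ℕ → Prop) {p : ℕ → ℕ}
    (hp : ∀ i, p i = countFrom D i (α.colLen 0 - 1)) :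
    SatisfiesInequalities α p ν ↔
      (∀ i, ∑ q ∈ range i, α.rowLen q ≤ ∑ q ∈ range i, ν.rowLen q) ∧
      ∀ i < α.colLen 0, ν.rowLen i + countFrom D i (α.colLen 0 - 1) ≤
        ∑ q ∈ Ico i (α.colLen 0), α.rowLen q := by
  have hsum : ∀ i, ∑ q ∈ range i, ν.rowLen q ≤ α.card := by
    intro i
    rw [← hν, card_eq_sum_rowLen ν (le_max_left _ i)]
    exact sum_le_sum_of_subset (range_subset_range.2 (le_max_right _ _))
  constructor
  · rintro ⟨h1, -, h3⟩
    refine ⟨h1, fun i hi => ?_⟩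
    rw [← hp]
    rcases Nat.eq_zero_or_pos (p i) with h0 | h0
    · have h4 := h1 i
      have h5 := hsum (i + 1)
      rw [sum_range_succ] at h5
      have h6 := sum_range_add_sum_Ico α.rowLen hi.le
      rw [← card_eq_sum_rowLen α le_rfl] at h6
      omega
    · exact h3 i h0
  · rintro ⟨h1, h2⟩
    have h0 : ν.rowLen 0 + p 0 ≤ α.card := by
      rcases Nat.eq_zero_or_pos (α.colLen 0) with hk | hk
      · have := hsum 1
        rw [hp, hk, countFrom_of_le D (by simp)]
        simpa using this
      · rw [hp, card_eq_sum_rowLen α le_rfl, range_eq_Ico]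
        exact h2 0 hk
    refine ⟨h1, fun i => ?_, fun i hi => ?_⟩
    · rcases i with _ | _ | i
      · simp
      · simp [twoParts]
        omega
      · refine (hsum _).trans ?_
        rw [sum_range_succ', sum_range_succ']
        simp [twoParts]
        omega
    · have := countFrom_le D i (α.colLen 0 - 1)
      rw [hp] at hi ⊢
      exact h2 i (by omega)

end MonotoneRibbon

open MonotoneRibbon

theorem theorem1p2 (α ν : YoungDiagram) (hα : ∀ i < α.colLen 0, 2 ≤ α.rowLen i)
    (hν : ν.card = α.card) :
    (∀ lam mu : YoungDiagram, MonotoneRibbon.IsRibbonWithRows α lam mu →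
      (0 < MonotoneRibbon.lrCoeff lam mu ν ↔
        MonotoneRibbon.SatisfiesInequalities α (MonotoneRibbon.overlap lam mu) ν)) ∧
    ((∃ U : SemistandardYoungTableau ν, MonotoneRibbon.IsStandard U ∧
        MonotoneRibbon.descentSet U = MonotoneRibbon.partialSums α) ↔
      MonotoneRibbon.SatisfiesInequalities α (fun i => α.colLen 0 - (i + 1)) ν) := by
  have hNα := le_max_left (α.colLen 0) (ν.colLen 0)
  have hNν := le_max_right (α.colLen 0) (ν.colLen 0)
  have core : ∀ D : ℕ → Prop, _ := fun D =>
    exists_stripMatrix_iff (D := D) (antitone_rowLen α) (antitone_rowLen ν) hα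
      (fun i hi => rowLen_eq_zero hi) hNα (fun i hi => rowLen_eq_zero (hNν.trans hi))
      (by rw [← card_eq_sum_rowLen ν hNν, ← card_eq_sum_rowLen α hNα, hν])
  constructor
  · intro lam mu h
    rw [satisfiesInequalities_iff hν _ (h.overlap_eq hα), ← core, lrCoeff_pos_iff]
    constructor
    · rintro ⟨T, hT, hY⟩
      exact ⟨_, h.stripMatrix_rowCount hNν hT hY⟩
    · rintro ⟨X, hX⟩
      exact h.exists_tableau hα hNν hX
  -- With D always true, `countFrom` gives the overlapping partition of the connected ribbon.
  · rw [satisfiesInequalities_iff hν (fun _ => True) (fun i => by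
      simp [countFrom]
      omega), ← core]
    constructor
    · rintro ⟨U, hU, hdes⟩
      exact ⟨_, stripMatrix_of_descentSet (fun i hi => by have := hα i hi; omega) hν hNν hU hdes⟩
    · rintro ⟨X, hX⟩
      exact hX.exists_standard hNν
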